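/- Let $G$ be a (finite-dimensional) Lie group with Lie algebra $\mathfrak g$ (standard bracket $[\cdot,\cdot]=\operatorname{ad}$), acting smoothly and transitively from the left on a smooth manifold $Q$. For $\xi\in\mathfrak g$ let $\xi_Q(q)=\frac{d}{dt}\big|_{t=0}\exp(t\xi)q$, and let $\xi_G(g)=TR_g\,\xi$ be the generator for the action of $G$ on itself by left translations, where $R_g$ is right translation; for each $g\in G$ and $v\in T_gG$ there is a unique $\xi$ with $v=\xi_G(g)$. Let $\gamma$ be a right-invariant Riemannian metric on $G$, with $\flat,\sharp$ the induced isomorphisms between $\mathfrak g$ and $\mathfrak g^*$, $\langle\operatorname{ad}^*_\nu\mu,\eta\rangle=\langle\mu,[\nu,\eta]\rangle$ and $\operatorname{ad}^\dagger_\nu\kappa=(\operatorname{ad}^*_\nu\kappa^\flat)^\sharp$. Let $\gamma_Q$ be the normal metric on $Q$: the inner product on each $T_qQ$ with $\gamma_Q(v,v)=\min\{\gamma(\xi,\xi)\mid \xi\in\mathfrak g,\ \xi_Q(q)=v\}$. Put $\mathfrak g^V_q=\{\xi\mid\xi_Q(q)=0\}$ and $\mathfrak g^H_q=(\mathfrak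 g^V_q)^\perp$, with orthogonal projections $V_q$ and $H_q$. Let $\nabla$ and $\frac{D}{Dt}$ denote the Levi-Civita covariant derivatives of $\gamma$ and of $\gamma_Q$. All curves are defined on a nondegenerate interval $J\subseteq\mathbb R$ (with one-sided derivatives at endpoints contained in $J$), and the formulas hold at every $t\in J$. **(i)** Let $g(t)$ be a $C^2$ curve in $G$ and define $\xi(t)\in\mathfrak g$ by $\dot g=\xi_G(g)$. Then $\xi$ is $C^1$ and $$\frac{D}{Dt}\dot g=\big(\dot\xi+\operatorname{ad}^\dagger_\xi\xi\big)_G(g).$$ **(ii)** Let $g(t)$ be a $C^1$ curve in $G$ and $V(t)\in T_{g(t)}G$ a $C^1$ vector field along it, and define $\xi(t),\nu(t)\in\mathfrak g$ by $\dot g=\xi_G(g)$ and $V=\nu_G(g)$. Then $\nu$ is $C^1$ and $$\frac{D}{Dt}V=\Big(\dot\nu+\tfrac12\operatorname{ad}^\dagger_\xi\nu+\tfrac12\operatorname{ad}^\dagger_\nu\xi-\tfrac12[\xi,\nu]\Big)_G(g).$$ If $M(t)\in T^*_{g(t)}G$ is a $C^1$ covector field along $g$ and $\mu=(TR_g)^*M\in\mathfrak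 g^*$, then $\mu$ is $C^1$ and $$\frac{D}{Dt}M=(TR_{g^{-1}})^*\Big(\dot\mu-\tfrac12\big(\operatorname{ad}_\xi(\mu^\sharp)\big)^\flat+\tfrac12\operatorname{ad}^*_{\mu^\sharp}\xi^\flat+\tfrac12\operatorname{ad}^*_\xi\mu\Big).$$ **(iii)** Let $q(t)$ be a $C^2$ curve in $Q$ and $\xi(t)\in\mathfrak g$ a $C^1$ curve with $\dot q=\xi_Q(q)$. Then $$\frac{D}{Dt}\dot q=\Big(\dot\xi+\operatorname{ad}^\dagger_{H_q(\xi)}H_q(\xi)\Big)_Q(q)+\nabla_{\dot q}\big(V_q(\xi)\big)_Q,$$ where in the last term, at time $t$, the vector field on $Q$ that is differentiated is generated by the fixed element $V_{q(t)}(\xi(t))\in\mathfrak g$. In particular, if $\xi(t)\in\mathfrak g^H_{q(t)}$ for all $t$ and $\dot q=\xi_Q(q)$, then $\xi$ is $C^1$ and $$\frac{D}{Dt}\dot q=\big(\dot\xi+\operatorname{ad}^\dagger_\xi\xi\big)_Q(q).$$ **(iv)** Let $\mathbf J:T^*Q\to\mathfrak g^*$, $\langle\mathbf J(\alpha_q),\xi\rangle=\langle\alpha_q,\xi_Q(q)\rangle$,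 be the momentum map of the cotangent-lifted action, and put $\bar{\mathbf J}(v_q)=\big(\mathbf J(v_q^\flat)\big)^\sharp$, with $v_q^\flat=\gamma_Q(v_q,\cdot)$. For every $v_q\in T_qQ$, $\bar{\mathbf J}(v_q)$ is the unique $\xi\in\mathfrak g^H_q$ with $\xi_Q(q)=v_q$; so the unique horizontal generator of a curve $q(t)$ in $Q$ is $\bar{\mathbf J}(\dot q)$. If $q$ is $C^2$, then $\bar{\mathbf J}(\dot q)$ is $C^1$ and $$\frac{D}{Dt}\dot q=\Big(\partial_t\bar{\mathbf J}(\dot q)+\operatorname{ad}^\dagger_{\bar{\mathbf J}(\dot q)}\bar{\mathbf J}(\dot q)\Big)_Q(q).$$ -/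

import Mathlib

open scoped Manifold ContDiff

noncomputable section

namespace NormalMetrics

instance instLEInftyMinSmoothness : ENat.LEInfty (minSmoothness ℝ 3) := ⟨by
  rw [minSmoothness_of_isRCLikeNormedField]; exact ENat.LEInfty.out⟩

/-- The Christoffel map `Γ(y)(u, v)` of a field `g` of bilinear forms on the vector space `E`:
`g(Γ(u, v), w) = (D_u g (v, w) + D_v g (u, w) - D_w g (u, v)) / 2` for all `w`. -/
def christoffelMap {E : Type*} [NormedAddCommGroup E] [NormedSpace ℝ E]
    (g : E → E →L[ℝ] E →L[ℝ] ℝ) (y u v : E) : E :=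
  let dg : E →L[ℝ] E →L[ℝ] E →L[ℝ] ℝ := fderiv ℝ g y
  let l : E →L[ℝ] ℝ := (1 / 2 : ℝ) • (dg u v + dg v u - (dg.flip u).flip v)
  (g y).inverse l

/-! ### The Levi-Civita connection in charts

`M` is a smooth manifold modelled on a finite-dimensional real vector space `E`, and
`γ` is a family of bilinear forms on its tangent spaces (a Riemannian metric in all uses). -/

section LeviCivita

variable {E : Type*} [NormedAddCommGroup E] [NormedSpace ℝ E]
  {M : Type*} [TopologicalSpace M] [ChartedSpace E M]

/-- The velocity `q̇(t)` of a curve `q : J → M` defined on an interval `J` (one-sided at the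
endpoints that belong to `J`). -/
def velocity (q : ℝ → M) (J : Set ℝ) (t : ℝ) : TangentSpace 𝓘(ℝ, E) (q t) :=
  mfderivWithin 𝓘(ℝ, ℝ) 𝓘(ℝ, E) q J t (1 : ℝ)

/-- The differential at `x`, from `T_x M` to `E`, of the preferred chart around `c`. -/
def chartDeriv (c x : M) : TangentSpace 𝓘(ℝ, E) x →L[ℝ] E :=
  mfderiv 𝓘(ℝ, E) 𝓘(ℝ, E) (extChartAt 𝓘(ℝ, E) c) x

/-- The local representative `y ↦ g_{ij}(y)` of `γ` in the preferred chart around `c`. -/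
def chartMetric (γ : ∀ x : M, TangentSpace 𝓘(ℝ, E) x →L[ℝ] TangentSpace 𝓘(ℝ, E) x →L[ℝ] ℝ)
    (c : M) (y : E) : E →L[ℝ] E →L[ℝ] ℝ :=
  let x : M := (extChartAt 𝓘(ℝ, E) c).symm y
  let A : E →L[ℝ] E := (chartDeriv (E := E) c x).inverse
  let γx : E →L[ℝ] E →L[ℝ] ℝ := γ x
  γx.bilinearComp A A

/-- The Christoffel map of `γ` in the preferred chart around `c`. -/
def christoffel (γ : ∀ x : M, TangentSpace 𝓘(ℝ, E) x →L[ℝ] TangentSpace 𝓘(ℝ, E) x →L[ℝ] ℝ)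
    (c : M) (y u v : E) : E :=
  christoffelMap (chartMetric γ c) y u v

/-- The covariant derivative `D V / Dt` along the curve `q : J → M` of the vector field
`V(t) ∈ T_{q(t)} M`, given by `v̇^k + Γ^k_{ij} ẋ^i v^j` in the preferred chart around `q(t)`. -/
def covDerivAlong
    (γ : ∀ x : M, TangentSpace 𝓘(ℝ, E) x →L[ℝ] TangentSpace 𝓘(ℝ, E) x →L[ℝ] ℝ)
    (q : ℝ → M) (V : ∀ t, TangentSpace 𝓘(ℝ, E) (q t)) (J : Set ℝ) (t : ℝ) :
    TangentSpace 𝓘(ℝ, E) (q t) :=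
  let x : ℝ → E := fun s ↦ extChartAt 𝓘(ℝ, E) (q t) (q s)
  let v : ℝ → E := fun s ↦ chartDeriv (q t) (q s) (V s)
  (chartDeriv (q t) (q t)).inverse
    (derivWithin v J t + christoffel γ (q t) (x t) (derivWithin x J t) (v t))

/-- The covariant derivative `D α / Dt` along the curve `q : J → M` of the covector field
`α(t) ∈ T*_{q(t)} M`, given by `α̇_k - Γ^i_{jk} ẋ^j α_i` in the preferred chart around `q(t)`. -/
def covDerivAlongCovector
    (γ : ∀ x : M, TangentSpace 𝓘(ℝ, E) x →L[ℝ] TangentSpace 𝓘(ℝ, E) x →L[ℝ] ℝ)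
    (q : ℝ → M) (α : ∀ t, TangentSpace 𝓘(ℝ, E) (q t) →L[ℝ] ℝ) (J : Set ℝ) (t : ℝ)
    (w : TangentSpace 𝓘(ℝ, E) (q t)) : ℝ :=
  let x : ℝ → E := fun s ↦ extChartAt 𝓘(ℝ, E) (q t) (q s)
  let a : ℝ → E →L[ℝ] ℝ := fun s ↦ (α s).comp (chartDeriv (q t) (q s)).inverse
  let w' : E := chartDeriv (q t) (q t) w
  derivWithin a J t w' - a t (christoffel γ (q t) (x t) (derivWithin x J t) w')

/-- The covariant derivative `∇_v X` at `p` of the vector field `X` on `M` in the direction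
`v ∈ T_p M`, given by `DX(v) + Γ(v, X)` in the preferred chart around `p`. -/
def covDeriv
    (γ : ∀ x : M, TangentSpace 𝓘(ℝ, E) x →L[ℝ] TangentSpace 𝓘(ℝ, E) x →L[ℝ] ℝ)
    (X : ∀ x : M, TangentSpace 𝓘(ℝ, E) x) (p : M) (v : TangentSpace 𝓘(ℝ, E) p) :
    TangentSpace 𝓘(ℝ, E) p :=
  let φ := extChartAt 𝓘(ℝ, E) p
  let X' : E → E := fun y ↦ chartDeriv p (φ.symm y) (X (φ.symm y))
  let u : E := chartDeriv p p v
  (chartDeriv p p).inverse (fderiv ℝ X' (φ p) u + christoffel γ p (φ p) u (X' (φ p)))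

end LeviCivita

/-! ### Lie groups with a right-invariant metric -/

section LieGroup

variable {E : Type*} [NormedAddCommGroup E] [NormedSpace ℝ E]
  {G : Type*} [TopologicalSpace G] [ChartedSpace E G] [Group G] [LieGroup 𝓘(ℝ, E) ∞ G]

/-- Right-invariance of a Riemannian metric: every right translation is an isometry. -/
def IsRightInvariant
    (γ : Bundle.ContMDiffRiemannianMetric 𝓘(ℝ, E) ∞ E (TangentSpace 𝓘(ℝ, E) : G → Type _)) : Prop :=
  ∀ (g h : G) (u v : TangentSpace 𝓘(ℝ, E) h),
    γ.inner (h * g) (mfderiv 𝓘(ℝ, E) 𝓘(ℝ, E) (fun k ↦ k * g) h u)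
      (mfderiv 𝓘(ℝ, E) 𝓘(ℝ, E) (fun k ↦ k * g) h v) = γ.inner h u v

/-- The differential `TR_g : 𝔤 → T_g G` of right translation by `g`. -/
def rightTrans (g : G) : GroupLieAlgebra 𝓘(ℝ, E) G →L[ℝ] TangentSpace 𝓘(ℝ, E) g :=
  mfderiv 𝓘(ℝ, E) 𝓘(ℝ, E) (fun k ↦ k * g) 1

/-- The differential `TR_{g⁻¹} : T_g G → 𝔤` of right translation by `g⁻¹`. -/
def rightTransInv (g : G) : TangentSpace 𝓘(ℝ, E) g →L[ℝ] GroupLieAlgebra 𝓘(ℝ, E) G :=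
  mfderiv 𝓘(ℝ, E) 𝓘(ℝ, E) (fun k ↦ k * g⁻¹) g

/-- `ad_ν η = [ν, η]` for the Lie bracket of the Lie algebra of `G`, as a linear map in `η`. -/
def adL [FiniteDimensional ℝ E] (ν : GroupLieAlgebra 𝓘(ℝ, E) G) :
    GroupLieAlgebra 𝓘(ℝ, E) G →L[ℝ] GroupLieAlgebra 𝓘(ℝ, E) G :=
  haveI : CompleteSpace E := FiniteDimensional.complete ℝ E
  let f : E →ₗ[ℝ] E := LieAlgebra.ad ℝ (GroupLieAlgebra 𝓘(ℝ, E) G) ν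
  let L : E →L[ℝ] E := LinearMap.toContinuousLinearMap f
  L

/-- `ad*_ν μ`, the dual of `ad_ν`: `⟨ad*_ν μ, η⟩ = ⟨μ, [ν, η]⟩`. -/
def adStar [FiniteDimensional ℝ E] (ν : GroupLieAlgebra 𝓘(ℝ, E) G)
    (μ : GroupLieAlgebra 𝓘(ℝ, E) G →L[ℝ] ℝ) : GroupLieAlgebra 𝓘(ℝ, E) G →L[ℝ] ℝ :=
  μ.comp (adL ν)

variable (γ : Bundle.ContMDiffRiemannianMetric 𝓘(ℝ, E) ∞ E (TangentSpace 𝓘(ℝ, E) : G → Type _))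

/-- `ν^♭ = γ(ν, ·)` on the Lie algebra. -/
def flat (ν : GroupLieAlgebra 𝓘(ℝ, E) G) : GroupLieAlgebra 𝓘(ℝ, E) G →L[ℝ] ℝ :=
  γ.inner 1 ν

/-- `μ^♯`, the inverse of `♭` on the Lie algebra. -/
def sharp (μ : GroupLieAlgebra 𝓘(ℝ, E) G →L[ℝ] ℝ) : GroupLieAlgebra 𝓘(ℝ, E) G :=
  (γ.inner (1 : G)).inverse μ

/-- The metric adjoint `ad†_ν κ = (ad*_ν κ^♭)^♯`. -/
def adDagger [FiniteDimensional ℝ E]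
    (ν κ : GroupLieAlgebra 𝓘(ℝ, E) G) : GroupLieAlgebra 𝓘(ℝ, E) G :=
  sharp γ (adStar ν (flat γ κ))

end LieGroup

/-! ### Group actions and normal metrics -/

section Action

variable {E : Type*} [NormedAddCommGroup E] [NormedSpace ℝ E]
  {F : Type*} [NormedAddCommGroup F] [NormedSpace ℝ F]
  {G : Type*} [TopologicalSpace G] [ChartedSpace E G] [Group G]
  {Q : Type*} [TopologicalSpace Q] [ChartedSpace F Q] [MulAction G Q]

/-- The infinitesimal generator `ξ_Q(q) = d/dt|_{t=0} exp(tξ) q ∈ T_q Q`, as a linear function of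
`ξ ∈ 𝔤`: the differential at the identity of the orbit map `g ↦ g q`. For `Q = G` with the
action by left translations this is `ξ_G`. -/
def infGen (q : Q) : GroupLieAlgebra 𝓘(ℝ, E) G →L[ℝ] TangentSpace 𝓘(ℝ, F) q :=
  mfderiv 𝓘(ℝ, E) 𝓘(ℝ, F) (fun g : G ↦ g • q) 1

/-- `ξ_Q(q)` is the velocity at `0` of `c(t) q`, for every curve `c` in `G` through the identity
with velocity `ξ`; in particular for `c(t) = exp(tξ)`. -/
theorem infGen_eq_of_curve [ContMDiffSMul 𝓘(ℝ, E) 𝓘(ℝ, F) ∞ G Q] (q : Q) (c : ℝ → G)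
    (hc : c 0 = 1) (hd : MDifferentiableAt 𝓘(ℝ, ℝ) 𝓘(ℝ, E) c 0) :
    (mfderiv 𝓘(ℝ, ℝ) 𝓘(ℝ, F) (fun t ↦ c t • q) 0 (1 : ℝ) : F) =
      infGen (E := E) (G := G) q (mfderiv 𝓘(ℝ, ℝ) 𝓘(ℝ, E) c 0 (1 : ℝ)) := by
  have h : ContMDiff 𝓘(ℝ, E) 𝓘(ℝ, F) ∞ (fun g : G ↦ g • q) :=
    (contMDiff_id (I := 𝓘(ℝ, E))).smul (contMDiff_const (I' := 𝓘(ℝ, F)))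
  have h1 := mfderiv_comp_apply (I' := 𝓘(ℝ, E)) (0 : ℝ)
    (h.mdifferentiable (by simp) (c 0)) hd (1 : ℝ)
  unfold infGen
  rw [hc] at h1
  exact h1

variable [LieGroup 𝓘(ℝ, E) ∞ G]
  (γ : Bundle.ContMDiffRiemannianMetric 𝓘(ℝ, E) ∞ E (TangentSpace 𝓘(ℝ, E) : G → Type _))

/-- `γQ` is the normal metric on `Q` induced by the metric `γ` on `G`: a symmetric bilinear form
on each tangent space with `γQ(v, v) = min {γ(ξ, ξ) | ξ ∈ 𝔤, ξ_Q(q) = v}`. -/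
structure IsNormalMetric
    (γQ : ∀ q : Q, TangentSpace 𝓘(ℝ, F) q →L[ℝ] TangentSpace 𝓘(ℝ, F) q →L[ℝ] ℝ) : Prop where
  symm : ∀ (q : Q) (v w : TangentSpace 𝓘(ℝ, F) q), γQ q v w = γQ q w v
  isLeast : ∀ (q : Q) (v : TangentSpace 𝓘(ℝ, F) q),
    IsLeast {r : ℝ | ∃ ξ : GroupLieAlgebra 𝓘(ℝ, E) G, infGen q ξ = v ∧ r = γ.inner 1 ξ ξ}
      (γQ q v v)

variable (E F G) in
/-- The vertical subspace `𝔤^V_q = {ξ | ξ_Q(q) = 0}`. -/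
def vert (q : Q) : Submodule ℝ (GroupLieAlgebra 𝓘(ℝ, E) G) :=
  LinearMap.ker (infGen (E := E) (F := F) (G := G) q).toLinearMap

variable (F) in
/-- The horizontal subspace `𝔤^H_q`, the `γ`-orthogonal complement of `𝔤^V_q`. -/
def horiz (q : Q) : Submodule ℝ (GroupLieAlgebra 𝓘(ℝ, E) G) where
  carrier := {ξ | ∀ η ∈ vert E F G q, γ.inner 1 ξ η = 0}
  add_mem' {a b} ha hb η hη := by simp [ha η hη, hb η hη]
  zero_mem' η _ := by simp
  smul_mem' c a ha η hη := by simp [ha η hη]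

variable (F) in
theorem isCompl_horiz_vert [FiniteDimensional ℝ E] (q : Q) :
    IsCompl (horiz F γ q) (vert E F G q) := by
  have : FiniteDimensional ℝ (GroupLieAlgebra 𝓘(ℝ, E) G) :=
    inferInstanceAs (FiniteDimensional ℝ E)
  let B : LinearMap.BilinForm ℝ (GroupLieAlgebra 𝓘(ℝ, E) G) :=
    LinearMap.mk₂ ℝ (fun ξ η ↦ γ.inner 1 ξ η) (by simp) (by simp) (by simp) (by simp)
  have hB : B.IsRefl := fun x y h ↦ (γ.symm 1 y x).trans h
  have h1 : horiz F γ q = B.orthogonal (vert E F G q) := by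
    ext ξ
    exact forall₂_congr fun η _ ↦ by rw [γ.symm]; rfl
  rw [h1]
  refine ((LinearMap.BilinForm.isCompl_orthogonal_iff_disjoint hB).2 ?_).symm
  rw [Submodule.disjoint_def]
  intro x hx hx'
  by_contra h0
  exact (γ.pos 1 x h0).ne' (hx' x hx)

variable (F) in
/-- The orthogonal projection `H_q` of `𝔤` onto `𝔤^H_q`. -/
def horProj [FiniteDimensional ℝ E] (q : Q) (ξ : GroupLieAlgebra 𝓘(ℝ, E) G) :
    GroupLieAlgebra 𝓘(ℝ, E) G :=
  (horiz F γ q).projection (vert E F G q) (isCompl_horiz_vert F γ q) ξ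

variable (F) in
/-- The orthogonal projection `V_q` of `𝔤` onto `𝔤^V_q`. -/
def vertProj [FiniteDimensional ℝ E] (q : Q) (ξ : GroupLieAlgebra 𝓘(ℝ, E) G) :
    GroupLieAlgebra 𝓘(ℝ, E) G :=
  (vert E F G q).projection (horiz F γ q) (isCompl_horiz_vert F γ q).symm ξ

/-- The momentum map of the cotangent lifted action: `⟨J(α_q), ξ⟩ = ⟨α_q, ξ_Q(q)⟩`. -/
def momentumMap (q : Q) (α : TangentSpace 𝓘(ℝ, F) q →L[ℝ] ℝ) :
    GroupLieAlgebra 𝓘(ℝ, E) G →L[ℝ] ℝ :=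
  α.comp (infGen q)

/-- `J̄(v_q) = (J(v_q^♭))^♯`, with `♭` taken for `γQ` and `♯` for `γ`. -/
def horGen (γQ : ∀ q : Q, TangentSpace 𝓘(ℝ, F) q →L[ℝ] TangentSpace 𝓘(ℝ, F) q →L[ℝ] ℝ)
    (q : Q) (v : TangentSpace 𝓘(ℝ, F) q) : GroupLieAlgebra 𝓘(ℝ, E) G :=
  sharp γ (momentumMap q (γQ q v))

end Action

end NormalMetrics

end

open NormalMetrics

/-! In charts the action becomes a field of linear maps `A y : 𝔤 → F`, ξ ↦ ξ_Q, and the normal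
metric `g` is the quotient of the fixed inner product `k` on 𝔤: g(Aξ, Aζ) = k(ξ, ζ) as soon as one
of ξ, ζ is orthogonal to ker A (`IsNormalForm.apply_eq`). Hence `g` is inverse to the cometric A k⁻¹
A* and inherits the smoothness of A. The horizontal generator of v is k⁻¹ A* g v, which is the
momentum map formula of (iv); in particular it depends smoothly on v.

The main point is a maximum principle. If ν is horizontal at y, the function x ↦ g_x(A_x ν, A_x ν)
is bounded by k(ν, ν) and attains this bound at y, so its derivative there vanishes. Polarised
(`fderiv_isHor_apply`), this eliminates the derivatives of the metric from the Koszul formula. What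
remains are commutators of generators, and the action law turns these into Lie brackets, [ξ_Q, ζ_Q]
= -[ξ, ζ]_Q (`fderiv_generator_comm`, `fderiv_chartGen_comm`). For fixed ξ, ν horizontal at q this
gives ∇_{ξ_Q} ν_Q = (½ ad†_ξ ν + ½ ad†_ν ξ - ½ [ξ, ν])_Q at q (`fderiv_add_christoffelMap`); for a
time-dependent ν the product rule adds ν̇.

A right-invariant metric on G is the normal metric of G acting on itself by left translations, and
every Lie algebra element is then horizontal, so (i) and (ii) are the case Q = G. Covectors reduce
to vectors because the Levi-Civita connection is compatible with the metric. In (iii) the vertical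
part of ξ generates a field that vanishes at q, so its covariant derivative has no Christoffel term
and appears as the separate summand. -/

noncomputable section

namespace NormalMetrics

open Filter Topology

/-! ### Quotient inner products and horizontal lifts on a single tangent space. -/

section LinearAlgebra

variable {E : Type*} [NormedAddCommGroup E] [NormedSpace ℝ E]
  {F : Type*} [NormedAddCommGroup F] [NormedSpace ℝ F]

/-- `g` is the symmetric bilinear form on `F` induced by the bilinear form `k` on `E` and the
linear map `A : E → F`, with `g(v, v) = min {k(ξ, ξ) | A ξ = v}`. -/
structure IsNormalForm (k : E →L[ℝ] E →L[ℝ] ℝ) (A : E →L[ℝ] F) (g : F →L[ℝ] F →L[ℝ] ℝ) :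
    Prop where
  symm : ∀ v w, g v w = g w v
  isLeast : ∀ v, IsLeast {r : ℝ | ∃ ξ, A ξ = v ∧ r = k ξ ξ} (g v v)

/-- `ξ` is `k`-orthogonal to the kernel of `A`. -/
def IsHor (k : E →L[ℝ] E →L[ℝ] ℝ) (A : E →L[ℝ] F) (ξ : E) : Prop :=
  ∀ η, A η = 0 → k ξ η = 0

variable {k : E →L[ℝ] E →L[ℝ] ℝ} {A : E →L[ℝ] F} {g : F →L[ℝ] F →L[ℝ] ℝ} {ξ ζ : E}

theorem IsHor.add (hξ : IsHor k A ξ) (hζ : IsHor k A ζ) : IsHor k A (ξ + ζ) := fun η hη ↦ by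
  simp [hξ η hη, hζ η hη]

theorem IsNormalForm.le (h : IsNormalForm k A g) (ξ : E) : g (A ξ) (A ξ) ≤ k ξ ξ :=
  (h.isLeast (A ξ)).2 ⟨ξ, rfl, rfl⟩

/-- A minimiser of k on the fibre A ξ = v is orthogonal to ker A by the first variation. The
existence of the minimum also gives the surjectivity of A. -/
theorem IsNormalForm.exists_isHor (h : IsNormalForm k A g) (ks : ∀ x y, k x y = k y x)
    (v : F) : ∃ ξ, A ξ = v ∧ IsHor k A ξ := by
  obtain ⟨ξ, hξ, hr⟩ := (h.isLeast v).1
  refine ⟨ξ, hξ, fun η hη ↦ ?_⟩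
  -- This polynomial is k(ξ + tη, ξ + tη) - k(ξ, ξ), nonnegative by minimality. It has no constant
  -- term, so its discriminant is (2 k(ξ, η))², which must then be zero.
  have key : ∀ t : ℝ, 0 ≤ k η η * (t * t) + (2 * k ξ η) * t + 0 := fun t ↦ by
    have := h.le (ξ + t • η)
    simp only [map_add, map_smul, hη, smul_zero, add_zero, hξ, hr,
      add_apply, smul_apply, smul_eq_mul] at this
    rw [ks η ξ] at this
    linarith
  have := discrim_le_zero key
  simp only [discrim, mul_zero, sub_zero] at this
  have h2 : (2 * k ξ η) = 0 := pow_eq_zero_iff (two_ne_zero) |>.1 (le_antisymm this (sq_nonneg _))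
  linarith

/-- Conversely, a horizontal ξ is a minimiser: by orthogonality, any minimiser ζ on the same fibre
satisfies k(ζ, ζ) = k(ξ, ξ) + k(ζ - ξ, ζ - ξ). -/
theorem IsNormalForm.apply_self (h : IsNormalForm k A g) (ks : ∀ x y, k x y = k y x)
    (kp : ∀ x, x ≠ 0 → 0 < k x x) (hξ : IsHor k A ξ) : g (A ξ) (A ξ) = k ξ ξ := by
  refine le_antisymm (h.le ξ) ?_
  obtain ⟨ζ, hζ, hr⟩ := (h.isLeast (A ξ)).1
  have h0 := hξ (ζ - ξ) (by simp [hζ])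
  have h1 : 0 ≤ k (ζ - ξ) (ζ - ξ) := by
    rcases eq_or_ne (ζ - ξ) 0 with h | h
    · simp [h]
    · exact (kp _ h).le
  simp only [map_sub, sub_apply] at h0 h1
  rw [hr]
  linarith [ks ξ ζ]

/-- Polarisation of `IsNormalForm.apply_self`, after ζ is replaced by a horizontal element of its
fibre. Only one argument has to be horizontal; this matters because brackets of horizontal elements
need not be. -/
theorem IsNormalForm.apply_eq (h : IsNormalForm k A g) (ks : ∀ x y, k x y = k y x)
    (kp : ∀ x, x ≠ 0 → 0 < k x x) (hξ : IsHor k A ξ) (ζ : E) : g (A ξ) (A ζ) = k ξ ζ := by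
  obtain ⟨η, hη, hh⟩ := h.exists_isHor ks (A ζ)
  have h1 := h.apply_self ks kp (hξ.add hh)
  have h2 := h.apply_self ks kp hξ
  have h3 := h.apply_self ks kp hh
  have h4 := hξ (ζ - η) (by simp [hη])
  simp only [map_add, map_sub, add_apply] at h1 h4
  rw [← hη]
  linarith [h.symm (A ξ) (A η), ks ξ η]

theorem IsNormalForm.apply_eq' (h : IsNormalForm k A g) (ks : ∀ x y, k x y = k y x)
    (kp : ∀ x, x ≠ 0 → 0 < k x x) (hζ : IsHor k A ζ) (ξ : E) : g (A ξ) (A ζ) = k ξ ζ := by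
  rw [h.symm, ks, h.apply_eq ks kp hζ]

theorem isInvertible_of_pos [FiniteDimensional ℝ E] (kp : ∀ x, x ≠ 0 → 0 < k x x) :
    k.IsInvertible := by
  have hk : LinearMap.ker (k : E →ₗ[ℝ] E →L[ℝ] ℝ) = ⊥ := by
    rw [LinearMap.ker_eq_bot']
    intro x hx
    by_contra h0
    have := kp x h0
    rw [show k x = 0 from hx] at this
    simp at this
  have hfr : Module.finrank ℝ E = Module.finrank ℝ (E →L[ℝ] ℝ) := by
    rw [← (LinearMap.toContinuousLinearMap : (E →ₗ[ℝ] ℝ) ≃ₗ[ℝ] E →L[ℝ] ℝ).finrank_eq]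
    exact (Subspace.dual_finrank_eq (K := ℝ) (V := E)).symm
  let e := LinearEquiv.ofInjectiveOfFinrankEq (k : E →ₗ[ℝ] E →L[ℝ] ℝ) (LinearMap.ker_eq_bot.1 hk) hfr
  exact ⟨e.toContinuousLinearEquiv, by ext; rfl⟩

theorem isHor_inverse_comp (hk : k.IsInvertible) (α : F →L[ℝ] ℝ) :
    IsHor k A (k.inverse (α.comp A)) := fun η hη ↦ by
  rw [hk.self_apply_inverse]
  simp [hη]

/-- The cometric `A k⁻¹ A*`. -/
def cometric (k : E →L[ℝ] E →L[ℝ] ℝ) (A : E →L[ℝ] F) : (F →L[ℝ] ℝ) →L[ℝ] F :=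
  (A.comp k.inverse).comp ((ContinuousLinearMap.compL ℝ E F ℝ).flip A)

theorem cometric_apply (α : F →L[ℝ] ℝ) : cometric k A α = A (k.inverse (α.comp A)) := rfl

/-- The element k⁻¹ A* α is horizontal, so pairing its image with Aζ under g gives k(k⁻¹ A* α, ζ) =
α(Aζ). -/
theorem IsNormalForm.comp_cometric [FiniteDimensional ℝ E] (h : IsNormalForm k A g)
    (ks : ∀ x y, k x y = k y x) (kp : ∀ x, x ≠ 0 → 0 < k x x) :
    g.comp (cometric k A) = ContinuousLinearMap.id ℝ _ := by
  have hk := isInvertible_of_pos kp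
  ext α w
  obtain ⟨ζ, rfl, -⟩ := h.exists_isHor ks w
  simp only [ContinuousLinearMap.comp_apply, cometric_apply, ContinuousLinearMap.id_apply]
  rw [h.apply_eq ks kp (isHor_inverse_comp hk α), hk.self_apply_inverse]
  rfl

theorem IsNormalForm.pos (h : IsNormalForm k A g) (ks : ∀ x y, k x y = k y x)
    (kp : ∀ x, x ≠ 0 → 0 < k x x) (v : F) (hv : v ≠ 0) : 0 < g v v := by
  obtain ⟨ξ, rfl, hξ⟩ := h.exists_isHor ks v
  rw [h.apply_self ks kp hξ]
  exact kp _ fun h0 ↦ hv (by simp [h0])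

theorem IsNormalForm.inverse_cometric [FiniteDimensional ℝ E] [FiniteDimensional ℝ F]
    (h : IsNormalForm k A g) (ks : ∀ x y, k x y = k y x) (kp : ∀ x, x ≠ 0 → 0 < k x x) :
    (cometric k A).IsInvertible ∧ (cometric k A).inverse = g := by
  have hg := isInvertible_of_pos (h.pos ks kp)
  have h1 := h.comp_cometric ks kp
  have h2 : (cometric k A).comp g = ContinuousLinearMap.id ℝ _ := by
    have h3 : cometric k A = g.inverse := by
      ext α
      have := congrArg (fun L ↦ g.inverse (L α)) h1
      simpa [hg.inverse_apply_self] using this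
    ext v
    simp [h3, hg.inverse_apply_self]
  exact ⟨⟨ContinuousLinearEquiv.equivOfInverse' _ _ h2 h1, rfl⟩,
    ContinuousLinearMap.inverse_eq h2 h1⟩

/-- The horizontal lift is given by `k⁻¹ A* g`. -/
theorem IsNormalForm.isHor_iff [FiniteDimensional ℝ E] (h : IsNormalForm k A g)
    (ks : ∀ x y, k x y = k y x) (kp : ∀ x, x ≠ 0 → 0 < k x x) (v : F) (ξ : E) :
    (IsHor k A ξ ∧ v = A ξ) ↔ ξ = k.inverse ((g v).comp A) := by
  have hk := isInvertible_of_pos kp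
  have key : ∀ ξ v, IsHor k A ξ → v = A ξ → ξ = k.inverse ((g v).comp A) := by
    rintro ξ _ hξ rfl
    have : (g (A ξ)).comp A = k ξ := by ext ζ; exact h.apply_eq ks kp hξ ζ
    rw [this, hk.inverse_apply_self]
  refine ⟨fun h ↦ key ξ v h.1 h.2, fun e ↦ ?_⟩
  obtain ⟨ζ, hζ, hh⟩ := h.exists_isHor ks v
  rw [e, ← key ζ v hh hζ.symm]
  exact ⟨hh, hζ.symm⟩

end LinearAlgebra

/-! ### The Levi-Civita connection of a quotient metric. -/

section Koszul

variable {E : Type*} [NormedAddCommGroup E] [NormedSpace ℝ E] [FiniteDimensional ℝ E]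
  {F : Type*} [NormedAddCommGroup F] [NormedSpace ℝ F] [FiniteDimensional ℝ F]
  {k : E →L[ℝ] E →L[ℝ] ℝ} {A : F → E →L[ℝ] F} {g : F → F →L[ℝ] F →L[ℝ] ℝ} {y : F}

set_option maxSynthPendingDepth 6 in
-- The metric is the pointwise inverse of the cometric, which is polynomial in A, and inversion of
-- linear maps is smooth at invertible ones. Regularity of g thus need not be assumed.
theorem contDiffAt_of_isNormalForm {n : ℕ∞ω} (ks : ∀ x y, k x y = k y x)
    (kp : ∀ x, x ≠ 0 → 0 < k x x) (hA : ContDiffAt ℝ n A y)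
    (hg : ∀ᶠ x in 𝓝 y, IsNormalForm k (A x) (g x)) : ContDiffAt ℝ n g y := by
  have : CompleteSpace F := FiniteDimensional.complete ℝ F
  have hc : ContDiffAt ℝ n (fun x ↦ cometric k (A x)) y :=
    (hA.clm_comp contDiffAt_const).clm_comp
      ((contDiffAt_const (c := (ContinuousLinearMap.compL ℝ E F ℝ).flip)).clm_apply hA)
  have hi := (hg.self_of_nhds.inverse_cometric ks kp).1
  refine (hi.contDiffAt_map_inverse.comp y hc).congr_of_eventuallyEq ?_
  filter_upwards [hg] with x hx
  exact (hx.inverse_cometric ks kp).2.symm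

omit [FiniteDimensional ℝ F] in
theorem fderiv_apply_symm (hgd : DifferentiableAt ℝ g y)
    (hs : ∀ᶠ x in 𝓝 y, ∀ a b, g x a b = g x b a) (u a b : F) :
    fderiv ℝ g y u a b = fderiv ℝ g y u b a := by
  have e1 := (hgd.hasFDerivAt.clm_apply (hasFDerivAt_const a y)).clm_apply (hasFDerivAt_const b y)
  have e2 := (hgd.hasFDerivAt.clm_apply (hasFDerivAt_const b y)).clm_apply (hasFDerivAt_const a y)
  have e3 := e1.congr_of_eventuallyEq (f₁ := fun x ↦ g x b a) (by
    filter_upwards [hs] with x hx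
    exact hx b a)
  have := congrArg (fun L ↦ L u) (e2.unique e3)
  simpa using this.symm

omit [FiniteDimensional ℝ E] [FiniteDimensional ℝ F] in
/-- The scalar products of horizontal generators are stationary. -/
theorem fderiv_isHor_apply (ks : ∀ x y, k x y = k y x)
    (kp : ∀ x, x ≠ 0 → 0 < k x x) (hA : DifferentiableAt ℝ A y) (hgd : DifferentiableAt ℝ g y)
    (hg : ∀ᶠ x in 𝓝 y, IsNormalForm k (A x) (g x)) {ν ζ : E}
    (hν : IsHor k (A y) ν) (hζ : IsHor k (A y) ζ) (u : F) :
    fderiv ℝ g y u (A y ν) (A y ζ) + g y (fderiv ℝ A y u ν) (A y ζ)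
      + g y (A y ν) (fderiv ℝ A y u ζ) = 0 := by
  have hd : ∀ ν ζ : E, HasFDerivAt (fun x ↦ g x (A x ν) (A x ζ))
      (fderiv ℝ (fun x ↦ g x (A x ν) (A x ζ)) y) y := fun ν ζ ↦
    ((hgd.clm_apply (hA.clm_apply (differentiableAt_const ν))).clm_apply
      (hA.clm_apply (differentiableAt_const ζ))).hasFDerivAt
  have hv : ∀ ν ζ : E, fderiv ℝ (fun x ↦ g x (A x ν) (A x ζ)) y u =
      fderiv ℝ g y u (A y ν) (A y ζ) + g y (fderiv ℝ A y u ν) (A y ζ)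
      + g y (A y ν) (fderiv ℝ A y u ζ) := fun ν ζ ↦ by
    have h1 := hA.hasFDerivAt.clm_apply (hasFDerivAt_const ν y)
    have h2 := hA.hasFDerivAt.clm_apply (hasFDerivAt_const ζ y)
    rw [((hgd.hasFDerivAt.clm_apply h1).clm_apply h2).fderiv]
    simp
    ring
  have h0 : ∀ ν : E, IsHor k (A y) ν → fderiv ℝ (fun x ↦ g x (A x ν) (A x ν)) y = 0 := by
    intro ν hν
    -- At nearby x the value is at most k(ν, ν), as g_x is a minimum over a fibre containing ν; at y
    -- it equals k(ν, ν) since ν is horizontal there.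
    refine IsLocalMax.fderiv_eq_zero ?_
    filter_upwards [hg] with x hx
    rw [hg.self_of_nhds.apply_self ks kp hν]
    exact hx.le ν
  have a1 := hv ν ν
  have a2 := hv ζ ζ
  have a3 := hv (ν + ζ) (ν + ζ)
  rw [h0 _ hν] at a1
  rw [h0 _ hζ] at a2
  rw [h0 _ (hν.add hζ)] at a3
  have hs : ∀ a b, g y a b = g y b a := hg.self_of_nhds.symm
  have hs' := fderiv_apply_symm hgd (hg.mono fun _ h ↦ h.symm) u
  -- The identity for ν + ζ minus those for ν and ζ is twice the claim.
  simp only [map_add, add_apply, zero_apply] at a1 a2 a3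
  linarith [hs (A y ζ) (fderiv ℝ A y u ν), hs (A y ν) (fderiv ℝ A y u ζ), hs' (A y ν) (A y ζ)]

omit [FiniteDimensional ℝ F] in
theorem apply_christoffelMap (hi : (g y).IsInvertible) (u v w : F) :
    g y (christoffelMap g y u v) w =
      1 / 2 * (fderiv ℝ g y u v w + fderiv ℝ g y v u w - fderiv ℝ g y w u v) := by
  unfold christoffelMap
  rw [hi.self_apply_inverse]
  simp

omit [FiniteDimensional ℝ F] in
/-- The Christoffel map is compatible with the metric. -/
theorem fderiv_sub_christoffelMap (hi : (g y).IsInvertible) (hgd : DifferentiableAt ℝ g y)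
    (hs : ∀ᶠ x in 𝓝 y, ∀ a b, g x a b = g x b a) (u v w : F) :
    fderiv ℝ g y u v w - g y v (christoffelMap g y u w) = g y (christoffelMap g y u v) w := by
  rw [hs.self_of_nhds v, apply_christoffelMap hi, apply_christoffelMap hi]
  linarith [fderiv_apply_symm hgd hs u v w, fderiv_apply_symm hgd hs v u w,
    fderiv_apply_symm hgd hs w u v]

/-- The covariant derivative of a horizontal generator in a horizontal direction. -/
theorem fderiv_add_christoffelMap (ks : ∀ x y, k x y = k y x)
    (kp : ∀ x, x ≠ 0 → 0 < k x x) (hA : ContDiffAt ℝ 1 A y)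
    (hg : ∀ᶠ x in 𝓝 y, IsNormalForm k (A x) (g x)) {c : E → E → E}
    (hc : ∀ ξ ζ, fderiv ℝ A y (A y ζ) ξ - fderiv ℝ A y (A y ξ) ζ = A y (c ξ ζ)) {ξ ν σ : E}
    (hξ : IsHor k (A y) ξ) (hν : IsHor k (A y) ν)
    (hσ : ∀ ζ, 2 * k σ ζ = k ξ (c ν ζ) + k ν (c ξ ζ) - k (c ξ ν) ζ) :
    fderiv ℝ A y (A y ξ) ν + christoffelMap g y (A y ξ) (A y ν) = A y σ := by
  have hn := hg.self_of_nhds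
  have hi := isInvertible_of_pos (hn.pos ks kp)
  have hgd := (contDiffAt_of_isNormalForm ks kp hA hg).differentiableAt one_ne_zero
  have hAd := hA.differentiableAt one_ne_zero
  obtain ⟨e, he⟩ := hi
  refine e.injective (ContinuousLinearMap.ext fun w ↦ ?_)
  have he' : ∀ v, e v = g y v := fun v ↦ by rw [← he]; rfl
  rw [he', he']
  -- Test vectors may be taken as Aζ with ζ horizontal, so stationarity applies to all three pairs
  -- from ξ, ν, ζ.
  obtain ⟨ζ, rfl, hζ⟩ := hn.exists_isHor ks w
  rw [map_add, add_apply, apply_christoffelMap ⟨e, he⟩, hn.apply_eq' ks kp hζ]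
  -- `h1`, `h2`, `h3` express the three metric derivatives of the Koszul formula through derivatives
  -- of A; `c1`, `c2`, `c3` then turn the remaining antisymmetric combinations into brackets.
  have h1 := fderiv_isHor_apply ks kp hAd hgd hg hν hζ (A y ξ)
  have h2 := fderiv_isHor_apply ks kp hAd hgd hg hξ hζ (A y ν)
  have h3 := fderiv_isHor_apply ks kp hAd hgd hg hξ hν (A y ζ)
  have c1 := congrArg (fun v ↦ g y v (A y ν)) (hc ξ ζ)
  have c2 := congrArg (fun v ↦ g y v (A y ξ)) (hc ν ζ)
  have c3 := congrArg (fun v ↦ g y v (A y ζ)) (hc ξ ν)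
  simp only [map_sub, sub_apply] at c1 c2 c3
  rw [hn.apply_eq' ks kp hν] at c1
  rw [hn.apply_eq' ks kp hξ] at c2
  rw [hn.apply_eq' ks kp hζ] at c3
  have hs := hn.symm
  linarith [hσ ζ, ks ν (c ξ ζ), ks ξ (c ν ζ), hs (A y ξ) (fderiv ℝ A y (A y ν) ζ),
    hs (A y ν) (fderiv ℝ A y (A y ξ) ζ), hs (A y ξ) (fderiv ℝ A y (A y ζ) ν),
    hs (A y ν) (fderiv ℝ A y (A y ζ) ξ)]

end Koszul

/-! ### Commutators of the generators of a local group action. -/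

section LocalAction

variable {E : Type*} [NormedAddCommGroup E] [NormedSpace ℝ E]
  {F : Type*} [NormedAddCommGroup F] [NormedSpace ℝ F]

/-- The derivative of a partial derivative in the first variable. -/
theorem hasFDerivAt_fderiv_left {H : Type*} [NormedAddCommGroup H] [NormedSpace ℝ H]
    {B : E × F → H} {z : E} {y : F} (hB : ContDiffAt ℝ 2 B (z, y)) :
    HasFDerivAt (fun x ↦ fderiv ℝ (fun w ↦ B (w, x)) z)
      ((((ContinuousLinearMap.compL ℝ E (E × F) H).flip (ContinuousLinearMap.inl ℝ E F)).comp
        (fderiv ℝ (fderiv ℝ B) (z, y))).comp (ContinuousLinearMap.inr ℝ E F)) y := by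
  have h1 : DifferentiableAt ℝ (fderiv ℝ B) (z, y) :=
    (hB.fderiv_right (m := 1) (by norm_num)).differentiableAt one_ne_zero
  have h2 : HasFDerivAt (fun x : F ↦ ((z, x) : E × F)) (ContinuousLinearMap.inr ℝ E F) y :=
    hasFDerivAt_prodMk_right z y
  have h3 := (((ContinuousLinearMap.compL ℝ E (E × F) H).flip
    (ContinuousLinearMap.inl ℝ E F)).hasFDerivAt.comp y (h1.hasFDerivAt.comp y h2))
  refine h3.congr_of_eventuallyEq ?_
  have h4 : ∀ᶠ p in 𝓝 (z, y), DifferentiableAt ℝ B p := by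
    filter_upwards [hB.eventually (by simp)] with p hp
    exact hp.differentiableAt two_ne_zero
  filter_upwards [h2.continuousAt.eventually h4] with x hx
  exact (hx.hasFDerivAt.comp z (hasFDerivAt_prodMk_left z x)).fderiv

/-- The derivative of a partial derivative in the second variable. -/
theorem hasFDerivAt_fderiv_right {H : Type*} [NormedAddCommGroup H] [NormedSpace ℝ H]
    {B : E × F → H} {z : E} {y : F} (hB : ContDiffAt ℝ 2 B (z, y)) :
    HasFDerivAt (fun w ↦ fderiv ℝ (fun x ↦ B (w, x)) y)
      ((((ContinuousLinearMap.compL ℝ F (E × F) H).flip (ContinuousLinearMap.inr ℝ E F)).comp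
        (fderiv ℝ (fderiv ℝ B) (z, y))).comp (ContinuousLinearMap.inl ℝ E F)) z := by
  have h1 : DifferentiableAt ℝ (fderiv ℝ B) (z, y) :=
    (hB.fderiv_right (m := 1) (by norm_num)).differentiableAt one_ne_zero
  have h2 : HasFDerivAt (fun w : E ↦ ((w, y) : E × F)) (ContinuousLinearMap.inl ℝ E F) z :=
    hasFDerivAt_prodMk_left z y
  have h3 := (((ContinuousLinearMap.compL ℝ F (E × F) H).flip
    (ContinuousLinearMap.inr ℝ E F)).hasFDerivAt.comp z (h1.hasFDerivAt.comp z h2))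
  refine h3.congr_of_eventuallyEq ?_
  have h4 : ∀ᶠ p in 𝓝 (z, y), DifferentiableAt ℝ B p := by
    filter_upwards [hB.eventually (by simp)] with p hp
    exact hp.differentiableAt two_ne_zero
  filter_upwards [h2.continuousAt.eventually h4] with w hw
  exact (hw.hasFDerivAt.comp y (hasFDerivAt_prodMk_right w y)).fderiv

/-- The generators of a local action satisfy the commutation relations of the local group. -/
theorem fderiv_generator_comm {m : E × E → E} {B : E × F → F} {z : E} {y : F}
    (hB : ContDiffAt ℝ 2 B (z, y)) (hm : ContDiffAt ℝ 2 m (z, z))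
    (hBy : B (z, y) = y) (hmz : ∀ᶠ w in 𝓝 z, m (w, z) = w)
    (hzm : ∀ᶠ w in 𝓝 z, m (z, w) = w)
    (hact : ∀ᶠ p in 𝓝 (z, z), B (p.1, B (p.2, y)) = B (m p, y)) (ξ ζ : E) :
    fderiv ℝ (fun x ↦ fderiv ℝ (fun w ↦ B (w, x)) z) y (fderiv ℝ (fun w ↦ B (w, y)) z ζ) ξ -
      fderiv ℝ (fun x ↦ fderiv ℝ (fun w ↦ B (w, x)) z) y (fderiv ℝ (fun w ↦ B (w, y)) z ξ) ζ =
    fderiv ℝ (fun w ↦ B (w, y)) z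
      (fderiv ℝ (fun w ↦ fderiv ℝ (fun x ↦ m (w, x)) z) z ξ ζ -
        fderiv ℝ (fun w ↦ fderiv ℝ (fun x ↦ m (w, x)) z) z ζ ξ) := by
  have hB1 : ∀ᶠ p in 𝓝 (z, y), DifferentiableAt ℝ B p := by
    filter_upwards [hB.eventually (by simp)] with p hp
    exact hp.differentiableAt two_ne_zero
  have hm1 : ∀ᶠ p in 𝓝 (z, z), DifferentiableAt ℝ m p := by
    filter_upwards [hm.eventually (by simp)] with p hp
    exact hp.differentiableAt two_ne_zero
  have hsym := hB.isSymmSndFDerivAt (by simp)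
  set A := fderiv ℝ (fun w ↦ B (w, y)) z with hAdef
  set D := fderiv ℝ (fderiv ℝ B) (z, y) with hD
  have hBz : DifferentiableAt ℝ (fun w ↦ B (w, y)) z :=
    hB1.self_of_nhds.comp z (hasFDerivAt_prodMk_left z y).differentiableAt
  have hmm : m (z, z) = z := hmz.self_of_nhds
  -- the two expressions for the derivative of the action in the second factor
  have hP : (fun w ↦ (fderiv ℝ (fun x ↦ B (w, x)) y).comp A) =ᶠ[𝓝 z]
      fun w ↦ (fderiv ℝ (fun w ↦ B (w, y)) w).comp (fderiv ℝ (fun x ↦ m (w, x)) z) := by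
    have c1 : Tendsto (fun w : E ↦ (w, y)) (𝓝 z) (𝓝 (z, y)) :=
      (Continuous.prodMk_left y).continuousAt
    have c2 : Tendsto (fun w : E ↦ (w, z)) (𝓝 z) (𝓝 (z, z)) :=
      (Continuous.prodMk_left z).continuousAt
    filter_upwards [c1.eventually hB1, c2.eventually hm1, c2.eventually hact.eventually_nhds, hmz]
      with w h1 h2 h3 h4
    have e1 : HasFDerivAt (fun x ↦ B (w, B (x, y))) ((fderiv ℝ (fun x ↦ B (w, x)) y).comp A) z := by
      have : DifferentiableAt ℝ (fun x ↦ B (w, x)) (B (z, y)) := by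
        rw [hBy]
        exact h1.comp y (hasFDerivAt_prodMk_right w y).differentiableAt
      have := this.hasFDerivAt.comp z hBz.hasFDerivAt
      rwa [hBy] at this
    have e2 : HasFDerivAt (fun x ↦ B (m (w, x), y))
        ((fderiv ℝ (fun w ↦ B (w, y)) w).comp (fderiv ℝ (fun x ↦ m (w, x)) z)) z := by
      have a1 : DifferentiableAt ℝ (fun x ↦ m (w, x)) z :=
        h2.comp z (hasFDerivAt_prodMk_right w z).differentiableAt
      have a2 : DifferentiableAt ℝ (fun w ↦ B (w, y)) (m (w, z)) := by
        rw [h4]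
        exact h1.comp w (hasFDerivAt_prodMk_left w y).differentiableAt
      have := a2.hasFDerivAt.comp z a1.hasFDerivAt
      rwa [h4] at this
    refine e1.unique (e2.congr_of_eventuallyEq ?_)
    have c3 : Tendsto (fun x : E ↦ (w, x)) (𝓝 z) (𝓝 (w, z)) :=
      (Continuous.prodMk_right w).continuousAt
    exact c3.eventually h3
  have hA1 := (hasFDerivAt_fderiv_left hB).fderiv
  have hA2 := hasFDerivAt_fderiv_right hB
  have hm2 := hasFDerivAt_fderiv_right hm
  have hBB : HasFDerivAt (fderiv ℝ (fun w ↦ B (w, y)))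
      ((((ContinuousLinearMap.compL ℝ E (E × F) F).flip (ContinuousLinearMap.inl ℝ E F)).comp
        D).comp (ContinuousLinearMap.inl ℝ E F)) z := by
    have h1 : DifferentiableAt ℝ (fderiv ℝ B) (z, y) :=
      (hB.fderiv_right (m := 1) (by norm_num)).differentiableAt one_ne_zero
    have h2 : HasFDerivAt (fun w : E ↦ ((w, y) : E × F)) (ContinuousLinearMap.inl ℝ E F) z :=
      hasFDerivAt_prodMk_left z y
    have h3 := (((ContinuousLinearMap.compL ℝ E (E × F) F).flip
      (ContinuousLinearMap.inl ℝ E F)).hasFDerivAt.comp z (h1.hasFDerivAt.comp z h2))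
    refine h3.congr_of_eventuallyEq ?_
    filter_upwards [h2.continuousAt.eventually hB1] with w hw
    exact (hw.hasFDerivAt.comp w (hasFDerivAt_prodMk_left w y)).fderiv
  -- The action law has been differentiated in the second factor for all w near z; now both sides
  -- are differentiated in w at z.
  have hL := hA2.clm_comp (hasFDerivAt_const A z)
  have hR := hBB.clm_comp hm2
  have hLR := hL.unique (hR.congr_of_eventuallyEq hP)
  have hMz : fderiv ℝ (fun x ↦ m (z, x)) z = ContinuousLinearMap.id ℝ E :=
    ((hasFDerivAt_id z).congr_of_eventuallyEq hzm).fderiv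
  -- On the right the product rule leaves these two terms, because m(z, ·) is the identity near z
  -- and so has derivative id.
  have key : ∀ ξ ζ : E, D (ξ, 0) (0, A ζ) = D (ξ, 0) (ζ, 0) +
      A (fderiv ℝ (fun w ↦ fderiv ℝ (fun x ↦ m (w, x)) z) z ξ ζ) := fun ξ ζ ↦ by
    have := congrArg (fun L ↦ L ξ ζ) hLR
    rw [hm2.fderiv]
    simpa [hMz, hmm, add_comm] using this
  have e1 := key ξ ζ
  have e2 := key ζ ξ
  -- By symmetry of second derivatives the mixed term is the derivative of the generator of ξ along
  -- Aζ. The pure second derivative in the group variable is symmetric in ξ, ζ and cancels in the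
  -- difference.
  rw [hsym.eq (ξ, 0) (0, A ζ)] at e1
  rw [hsym.eq (ζ, 0) (0, A ξ), hsym.eq (ζ, 0) (ξ, 0)] at e2
  rw [hA1, map_sub]
  simp only [ContinuousLinearMap.comp_apply, ContinuousLinearMap.flip_apply,
    ContinuousLinearMap.compL_apply, ContinuousLinearMap.inl_apply, ContinuousLinearMap.inr_apply]
  rw [e1, e2]
  abel

end LocalAction

/-! ### Differentials of maps in charts, and brackets of linearly parametrised fields. -/

section Chart

variable {E : Type*} [NormedAddCommGroup E] [NormedSpace ℝ E]
  {M : Type*} [TopologicalSpace M] [ChartedSpace E M] [IsManifold 𝓘(ℝ, E) ∞ M]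

theorem chartDeriv_self (c : M) : chartDeriv (E := E) c c = ContinuousLinearMap.id ℝ E :=
  have : IsManifold 𝓘(ℝ, E) 1 M := .of_le (n := ∞) (by simp)
  mfderiv_extChartAt_self

theorem isInvertible_chartDeriv {c x : M} (hx : x ∈ (extChartAt 𝓘(ℝ, E) c).source) :
    (chartDeriv (E := E) c x).IsInvertible :=
  have : IsManifold 𝓘(ℝ, E) 1 M := .of_le (n := ∞) (by simp)
  isInvertible_mfderiv_extChartAt hx

theorem inverse_mfderivWithin_extChartAt_symm {c : M} {y : E}
    (hy : y ∈ (extChartAt 𝓘(ℝ, E) c).target) :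
    (mfderivWithin 𝓘(ℝ, E) 𝓘(ℝ, E) (extChartAt 𝓘(ℝ, E) c).symm (Set.range 𝓘(ℝ, E)) y).inverse =
      chartDeriv c ((extChartAt 𝓘(ℝ, E) c).symm y) :=
  have : IsManifold 𝓘(ℝ, E) 1 M := .of_le (n := ∞) (by simp)
  ContinuousLinearMap.inverse_eq (mfderivWithin_extChartAt_symm_comp_mfderiv_extChartAt hy)
    (mfderiv_extChartAt_comp_mfderivWithin_extChartAt_symm hy)

/-- The differential of a map between manifolds, expressed in charts. -/
theorem chartDeriv_mfderiv {E' : Type*} [NormedAddCommGroup E'] [NormedSpace ℝ E']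
    {M' : Type*} [TopologicalSpace M'] [ChartedSpace E' M']
    {f : M' → M} {p : M'} {c x : M} (hf : MDifferentiableAt 𝓘(ℝ, E') 𝓘(ℝ, E) f p)
    (hx : f p = x) (hp : x ∈ (extChartAt 𝓘(ℝ, E) c).source) (v : E') :
    chartDeriv c x (mfderiv 𝓘(ℝ, E') 𝓘(ℝ, E) f p v : E) =
      fderiv ℝ (fun z ↦ extChartAt 𝓘(ℝ, E) c (f ((extChartAt 𝓘(ℝ, E') p).symm z)))
        (extChartAt 𝓘(ℝ, E') p p) v := by
  have : IsManifold 𝓘(ℝ, E) 1 M := .of_le (n := ∞) (by simp)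
  subst hx
  rw [extChartAt_source] at hp
  have h1 := mdifferentiableAt_extChartAt (I := 𝓘(ℝ, E)) hp
  have h2 := mfderiv_comp p h1 hf
  have h3 := h1.comp p hf
  have h4 := congrArg (fun L ↦ L v) h2
  have h5 : fderivWithin ℝ (writtenInExtChartAt 𝓘(ℝ, E') 𝓘(ℝ, E) p (extChartAt 𝓘(ℝ, E) c ∘ f))
      (Set.range 𝓘(ℝ, E')) (extChartAt 𝓘(ℝ, E') p p) =
      fderiv ℝ (fun z ↦ extChartAt 𝓘(ℝ, E) c (f ((extChartAt 𝓘(ℝ, E') p).symm z)))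
        (extChartAt 𝓘(ℝ, E') p p) := by
    simp only [writtenInExtChartAt, extChartAt_model_space_eq_id, PartialEquiv.refl_coe,
      modelWithCornersSelf_coe, Set.range_id, fderivWithin_univ]
    rfl
  exact h4.symm.trans (congrArg (fun L : E' →L[ℝ] E ↦ L v) (h3.mfderiv.trans h5))

end Chart

theorem lieBracket_clm_apply {E : Type*} [NormedAddCommGroup E] [NormedSpace ℝ E]
    {N : E → E →L[ℝ] E} {z : E} (hd : DifferentiableAt ℝ N z)
    (hz : N z = ContinuousLinearMap.id ℝ E) (ξ ζ : E) :
    VectorField.lieBracket ℝ (fun w ↦ N w ξ) (fun w ↦ N w ζ) z =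
      fderiv ℝ N z ξ ζ - fderiv ℝ N z ζ ξ := by
  have h : ∀ η : E, fderiv ℝ (fun w ↦ N w η) z = (fderiv ℝ N z).flip η := fun η ↦ by
    rw [fderiv_clm_apply hd (differentiableAt_const η)]
    ext; simp
  rw [VectorField.lieBracket, hz, h, h]
  rfl

/-! ### Infinitesimal generators and the Lie bracket in charts. -/

section Action

variable {E : Type*} [NormedAddCommGroup E] [NormedSpace ℝ E]
  {F : Type*} [NormedAddCommGroup F] [NormedSpace ℝ F]
  {G : Type*} [TopologicalSpace G] [ChartedSpace E G] [Group G] [LieGroup 𝓘(ℝ, E) ∞ G]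
  {Q : Type*} [TopologicalSpace Q] [ChartedSpace F Q] [IsManifold 𝓘(ℝ, F) ∞ Q]
  [MulAction G Q] [ContMDiffSMul 𝓘(ℝ, E) 𝓘(ℝ, F) ∞ G Q]

variable (E F G) in
/-- The action in the preferred charts around `1` and `c`. -/
def localAction (c : Q) (p : E × F) : F :=
  extChartAt 𝓘(ℝ, F) c
    ((extChartAt 𝓘(ℝ, E) (1 : G)).symm p.1 • (extChartAt 𝓘(ℝ, F) c).symm p.2)

variable (E F G) in
/-- The infinitesimal generators in the preferred chart around `c`. -/
def chartGen (c : Q) (y : F) : E →L[ℝ] F :=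
  (chartDeriv c ((extChartAt 𝓘(ℝ, F) c).symm y)).comp
    (infGen (E := E) (G := G) ((extChartAt 𝓘(ℝ, F) c).symm y))

omit [LieGroup 𝓘(ℝ, E) ∞ G] [IsManifold 𝓘(ℝ, F) ∞ Q] [ContMDiffSMul 𝓘(ℝ, E) 𝓘(ℝ, F) ∞ G Q] in
theorem chartGen_apply (c : Q) (y : F) (ξ : GroupLieAlgebra 𝓘(ℝ, E) G) :
    chartGen E F G c y ξ = chartDeriv c ((extChartAt 𝓘(ℝ, F) c).symm y)
      (infGen (E := E) (G := G) ((extChartAt 𝓘(ℝ, F) c).symm y) ξ) := rfl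

omit [LieGroup 𝓘(ℝ, E) ∞ G] [IsManifold 𝓘(ℝ, F) ∞ Q] [ContMDiffSMul 𝓘(ℝ, E) 𝓘(ℝ, F) ∞ G Q] in
theorem chartGen_extChartAt {c x : Q} (hx : x ∈ (extChartAt 𝓘(ℝ, F) c).source)
    (ξ : GroupLieAlgebra 𝓘(ℝ, E) G) :
    chartGen E F G c (extChartAt 𝓘(ℝ, F) c x) ξ =
      chartDeriv c x (infGen (E := E) (G := G) x ξ) := by
  rw [chartGen_apply, (extChartAt 𝓘(ℝ, F) c).left_inv hx]

omit [LieGroup 𝓘(ℝ, E) ∞ G] [IsManifold 𝓘(ℝ, F) ∞ Q] in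
theorem contMDiff_orbit (q : Q) : ContMDiff 𝓘(ℝ, E) 𝓘(ℝ, F) ∞ (fun g : G ↦ g • q) :=
  (contMDiff_id (I := 𝓘(ℝ, E))).smul (contMDiff_const (I' := 𝓘(ℝ, F)))

omit [LieGroup 𝓘(ℝ, E) ∞ G] in
-- As a partial derivative of one smooth map between vector spaces, the generator field becomes
-- accessible to ordinary calculus: this gives both its smoothness in y and its commutation
-- relations.
theorem chartGen_eq_fderiv {c : Q} {y : F} (hy : y ∈ (extChartAt 𝓘(ℝ, F) c).target) :
    chartGen E F G c y = fderiv ℝ (fun z ↦ localAction E F G c (z, y))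
      (extChartAt 𝓘(ℝ, E) (1 : G) 1) := by
  set q := (extChartAt 𝓘(ℝ, F) c).symm y with hq
  have hs : q ∈ (extChartAt 𝓘(ℝ, F) c).source := (extChartAt 𝓘(ℝ, F) c).map_target hy
  have h1 : MDifferentiableAt 𝓘(ℝ, E) 𝓘(ℝ, F) (fun g : G ↦ g • q) 1 :=
    (contMDiff_orbit q).mdifferentiable (by simp) 1
  ext v
  exact chartDeriv_mfderiv (c := c) h1 (one_smul G q) hs v

theorem contDiffAt_localAction {c : Q} {y : F} (hy : y ∈ (extChartAt 𝓘(ℝ, F) c).target) :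
    ContDiffAt ℝ ∞ (localAction E F G c) (extChartAt 𝓘(ℝ, E) (1 : G) 1, y) := by
  have hs := (extChartAt 𝓘(ℝ, F) c).map_target hy
  rw [← contMDiffAt_iff_contDiffAt]
  have h1 : ContMDiffAt 𝓘(ℝ, E) 𝓘(ℝ, E) ∞ (extChartAt 𝓘(ℝ, E) (1 : G)).symm
      (extChartAt 𝓘(ℝ, E) (1 : G) 1) :=
    (contMDiffOn_extChartAt_symm (1 : G)).contMDiffAt (extChartAt_target_mem_nhds _)
  have h2 : ContMDiffAt 𝓘(ℝ, F) 𝓘(ℝ, F) ∞ (extChartAt 𝓘(ℝ, F) c).symm y :=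
    (contMDiffOn_extChartAt_symm c).contMDiffAt ((isOpen_extChartAt_target c).mem_nhds hy)
  have h1' : ContMDiffAt 𝓘(ℝ, E × F) 𝓘(ℝ, E) ∞
      (fun p : E × F ↦ (extChartAt 𝓘(ℝ, E) (1 : G)).symm p.1)
      (extChartAt 𝓘(ℝ, E) (1 : G) 1, y) :=
    ContMDiffAt.comp (x := (extChartAt 𝓘(ℝ, E) (1 : G) 1, y)) (I' := 𝓘(ℝ, E)) h1
      contDiff_fst.contMDiff.contMDiffAt
  have h2' : ContMDiffAt 𝓘(ℝ, E × F) 𝓘(ℝ, F) ∞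
      (fun p : E × F ↦ (extChartAt 𝓘(ℝ, F) c).symm p.2)
      (extChartAt 𝓘(ℝ, E) (1 : G) 1, y) :=
    ContMDiffAt.comp (x := (extChartAt 𝓘(ℝ, E) (1 : G) 1, y)) (I' := 𝓘(ℝ, F)) h2
      contDiff_snd.contMDiff.contMDiffAt
  have h3 := h1'.smul h2'
  have h4 : ContMDiffAt 𝓘(ℝ, F) 𝓘(ℝ, F) ∞ (extChartAt 𝓘(ℝ, F) c)
      ((extChartAt 𝓘(ℝ, E) (1 : G)).symm (extChartAt 𝓘(ℝ, E) (1 : G) 1) •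
        (extChartAt 𝓘(ℝ, F) c).symm y) := by
    rw [extChartAt_to_inv, one_smul]
    exact contMDiffAt_extChartAt' (by rwa [extChartAt_source] at hs)
  exact ContMDiffAt.comp (x := (extChartAt 𝓘(ℝ, E) (1 : G) 1, y)) (I' := 𝓘(ℝ, F)) h4 h3

theorem contDiffAt_chartGen {c : Q} {y : F} (hy : y ∈ (extChartAt 𝓘(ℝ, F) c).target) :
    ContDiffAt ℝ 1 (chartGen E F G c) y := by
  have h := (contDiffAt_localAction (E := E) (G := G) hy).of_le (m := 2) ENat.LEInfty.out
  have h1 : ContDiffAt ℝ 2 (Function.uncurry fun x z ↦ localAction E F G c (z, x))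
      (y, extChartAt 𝓘(ℝ, E) (1 : G) 1) :=
    ContDiffAt.comp (g := localAction E F G c) (y, extChartAt 𝓘(ℝ, E) (1 : G) 1) h
      (contDiff_snd.prodMk contDiff_fst).contDiffAt
  have h2 := h1.fderiv (m := 1) (g := fun _ ↦ extChartAt 𝓘(ℝ, E) (1 : G) 1)
    contDiffAt_const (by norm_num)
  refine h2.congr_of_eventuallyEq ?_
  filter_upwards [(isOpen_extChartAt_target c).mem_nhds hy] with x hx
  exact chartGen_eq_fderiv hx

/-- The Lie bracket on the Lie algebra in the preferred chart around `1`. -/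
theorem bracket_eq_fderiv (ξ ζ : GroupLieAlgebra 𝓘(ℝ, E) G) :
    (⁅ξ, ζ⁆ : GroupLieAlgebra 𝓘(ℝ, E) G) =
      (fderiv ℝ (fun w ↦ fderiv ℝ (fun x ↦ localAction E E G (1 : G) (w, x))
        (extChartAt 𝓘(ℝ, E) (1 : G) 1)) (extChartAt 𝓘(ℝ, E) (1 : G) 1) ξ ζ -
      fderiv ℝ (fun w ↦ fderiv ℝ (fun x ↦ localAction E E G (1 : G) (w, x))
        (extChartAt 𝓘(ℝ, E) (1 : G) 1)) (extChartAt 𝓘(ℝ, E) (1 : G) 1) ζ ξ : E) := by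
  set φ := extChartAt 𝓘(ℝ, E) (1 : G) with hφ
  have hz : φ 1 ∈ φ.target := mem_extChartAt_target (1 : G)
  have : IsManifold 𝓘(ℝ, E) 1 G := .of_le (n := ∞) (by simp)
  have hB := (contDiffAt_localAction (E := E) (G := G) (c := (1 : G)) hz).of_le (m := 2)
    ENat.LEInfty.out
  have hM := (hasFDerivAt_fderiv_right hB).differentiableAt
  set N : E → E →L[ℝ] E := fun w ↦ fderiv ℝ (fun x ↦ localAction E E G (1 : G) (w, x)) (φ 1)
    with hN
  -- The bracket is that of left-invariant fields; in the chart such a field is z ↦ N z ξ, with N z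
  -- the derivative of left translation and N = id at the identity.
  have hfield : ∀ ξ : GroupLieAlgebra 𝓘(ℝ, E) G,
      (VectorField.mpullbackWithin 𝓘(ℝ, E) 𝓘(ℝ, E) φ.symm (mulInvariantVectorField ξ)
        (Set.range 𝓘(ℝ, E)) : E → E) =ᶠ[𝓝 (φ 1)] fun z ↦ N z ξ := by
    intro ξ
    filter_upwards [extChartAt_target_mem_nhds (1 : G)] with z hz
    have hd : MDifferentiableAt 𝓘(ℝ, E) 𝓘(ℝ, E) (fun h : G ↦ φ.symm z * h) 1 :=
      (contMDiff_mul_left (n := ∞)).mdifferentiable (by simp) 1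
    have := chartDeriv_mfderiv (c := (1 : G)) hd (mul_one _) (φ.map_target hz) ξ
    exact (congrArg (fun L ↦ L (mulInvariantVectorField ξ (φ.symm z)))
      (inverse_mfderivWithin_extChartAt_symm hz)).trans this
  have hNz : N (φ 1) = ContinuousLinearMap.id ℝ E := by
    refine HasFDerivAt.fderiv ((hasFDerivAt_id (φ 1)).congr_of_eventuallyEq ?_)
    filter_upwards [extChartAt_target_mem_nhds (1 : G)] with z hz
    change φ (φ.symm (φ 1) * φ.symm z) = z
    rw [φ.left_inv (mem_extChartAt_source (1 : G)), one_mul, φ.right_inv hz]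
  rw [GroupLieAlgebra.bracket_def, ← VectorField.mlieBracketWithin_univ,
    VectorField.mlieBracketWithin_apply]
  have h1 : VectorField.lieBracketWithin ℝ
      (VectorField.mpullbackWithin 𝓘(ℝ, E) 𝓘(ℝ, E) φ.symm (mulInvariantVectorField ξ)
        (Set.range 𝓘(ℝ, E)))
      (VectorField.mpullbackWithin 𝓘(ℝ, E) 𝓘(ℝ, E) φ.symm (mulInvariantVectorField ζ)
        (Set.range 𝓘(ℝ, E))) (φ.symm ⁻¹' Set.univ ∩ Set.range 𝓘(ℝ, E)) (φ 1) =
      fderiv ℝ N (φ 1) ξ ζ - fderiv ℝ N (φ 1) ζ ξ := by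
    have e : φ.symm ⁻¹' Set.univ ∩ Set.range 𝓘(ℝ, E) = Set.univ := by simp
    rw [e]
    refine (congrFun (VectorField.lieBracketWithin_univ (𝕜 := ℝ) (E := E)) (φ 1)).trans ?_
    have h2 := Filter.EventuallyEq.lieBracket_vectorField_eq (𝕜 := ℝ) (hfield ξ) (hfield ζ)
    exact h2.trans (lieBracket_clm_apply hM hNz ξ ζ)
  rw [h1]
  have h4 : (mfderiv 𝓘(ℝ, E) 𝓘(ℝ, E) (extChartAt 𝓘(ℝ, E) (1 : G)) 1) =
    ContinuousLinearMap.id ℝ E := chartDeriv_self (1 : G)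
  rw [h4]
  exact congrArg (fun L : E →L[ℝ] E ↦ L _) ContinuousLinearMap.inverse_id

/-- The commutation relations of infinitesimal generators in a chart. -/
theorem fderiv_chartGen_comm (c : Q) (ξ ζ : GroupLieAlgebra 𝓘(ℝ, E) G) :
    fderiv ℝ (chartGen E F G c) (extChartAt 𝓘(ℝ, F) c c)
        (chartGen E F G c (extChartAt 𝓘(ℝ, F) c c) ζ) ξ -
      fderiv ℝ (chartGen E F G c) (extChartAt 𝓘(ℝ, F) c c)
        (chartGen E F G c (extChartAt 𝓘(ℝ, F) c c) ξ) ζ =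
      chartGen E F G c (extChartAt 𝓘(ℝ, F) c c) (⁅ξ, ζ⁆ : GroupLieAlgebra 𝓘(ℝ, E) G) := by
  set φ := extChartAt 𝓘(ℝ, E) (1 : G) with hφ
  set ψ := extChartAt 𝓘(ℝ, F) c with hψ
  have hz : φ 1 ∈ φ.target := mem_extChartAt_target (1 : G)
  have hy : ψ c ∈ ψ.target := mem_extChartAt_target c
  have hB := (contDiffAt_localAction (E := E) (G := G) (c := c) hy).of_le (m := 2)
    ENat.LEInfty.out
  have hm := (contDiffAt_localAction (E := E) (G := G) (c := (1 : G)) hz).of_le (m := 2)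
    ENat.LEInfty.out
  have h1 : ∀ᶠ w in 𝓝 (φ 1), localAction E E G (1 : G) (w, φ 1) = w := by
    filter_upwards [extChartAt_target_mem_nhds (1 : G)] with z hz
    change φ (φ.symm z * φ.symm (φ 1)) = z
    rw [φ.left_inv (mem_extChartAt_source (1 : G)), mul_one, φ.right_inv hz]
  have h2 : ∀ᶠ w in 𝓝 (φ 1), localAction E E G (1 : G) (φ 1, w) = w := by
    filter_upwards [extChartAt_target_mem_nhds (1 : G)] with z hz
    change φ (φ.symm (φ 1) * φ.symm z) = z
    rw [φ.left_inv (mem_extChartAt_source (1 : G)), one_mul, φ.right_inv hz]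
  have hBy : localAction E F G c (φ 1, ψ c) = ψ c := by simp [localAction, hφ, hψ]
  have hc : ContinuousAt φ.symm (φ 1) := continuousAt_extChartAt_symm (1 : G)
  have hc1 : ContinuousAt (fun p : E × E ↦ φ.symm p.1) (φ 1, φ 1) :=
    ContinuousAt.comp (f := Prod.fst) (x := (φ 1, φ 1)) hc continuousAt_fst
  have hc2 : ContinuousAt (fun p : E × E ↦ φ.symm p.2) (φ 1, φ 1) :=
    ContinuousAt.comp (f := Prod.snd) (x := (φ 1, φ 1)) hc continuousAt_snd
  have : ContinuousMul G := continuousMul_of_contMDiffMul 𝓘(ℝ, E) ∞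
  -- The action law holds in charts only while the product and the translated point stay inside the
  -- chart domains, hence near the identity.
  have hact : ∀ᶠ p in 𝓝 (φ 1, φ 1), localAction E F G c (p.1, localAction E F G c (p.2, ψ c)) =
      localAction E F G c (localAction E E G (1 : G) p, ψ c) := by
    have a1 : ∀ᶠ p in 𝓝 (φ 1, φ 1), φ.symm p.1 * φ.symm p.2 ∈ φ.source := by
      refine (hc1.mul hc2).eventually (extChartAt_source_mem_nhds' ?_)
      simp [hφ]
    have a2 : ∀ᶠ p in 𝓝 (φ 1, φ 1), φ.symm p.2 • c ∈ ψ.source := by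
      have : ContinuousAt (fun p : E × E ↦ φ.symm p.2 • c) (φ 1, φ 1) :=
        ContinuousAt.comp (f := fun p : E × E ↦ φ.symm p.2) (x := (φ 1, φ 1))
          (contMDiff_orbit (E := E) (F := F) c).continuous.continuousAt hc2
      refine this.eventually (extChartAt_source_mem_nhds' ?_)
      simp [hφ]
    filter_upwards [a1, a2] with p h1 h2
    simp only [localAction]
    rw [← hφ, ← hψ, ψ.left_inv (mem_extChartAt_source c), ψ.left_inv h2, smul_eq_mul,
      φ.left_inv h1, mul_smul]
  have key := fderiv_generator_comm hB hm hBy h1 h2 hact ξ ζ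
  have hA : chartGen E F G c =ᶠ[𝓝 (ψ c)]
      fun x ↦ fderiv ℝ (fun w ↦ localAction E F G c (w, x)) (φ 1) := by
    filter_upwards [extChartAt_target_mem_nhds c] with x hx
    exact chartGen_eq_fderiv hx
  rw [hA.fderiv_eq, hA.self_of_nhds, bracket_eq_fderiv]
  exact key

end Action

/-! ### Regularity of curves, vector fields and covector fields in charts. -/

section Curve

variable {E : Type*} [NormedAddCommGroup E] [NormedSpace ℝ E]
  {M : Type*} [TopologicalSpace M] [ChartedSpace E M]
  {q : ℝ → M} {J : Set ℝ} {t : ℝ}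

/-- The vector field `V` along `q` is continuously differentiable on `J`, in charts. -/
def ContDiffAlongOn (q : ℝ → M) (V : ∀ t, TangentSpace 𝓘(ℝ, E) (q t)) (J : Set ℝ) : Prop :=
  ∀ t ∈ J, ContDiffWithinAt ℝ 1 (F := E) (fun s ↦ chartDeriv (q t) (q s) (V s)) J t

theorem eventually_mem_source {n : ℕ∞ω} (hq : ContMDiffOn 𝓘(ℝ, ℝ) 𝓘(ℝ, E) n q J) (ht : t ∈ J) :
    ∀ᶠ s in 𝓝[J] t, q s ∈ (extChartAt 𝓘(ℝ, E) (q t)).source :=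
  (hq t ht).continuousWithinAt.eventually (extChartAt_source_mem_nhds (q t))

theorem contDiffWithinAt_chart {n : ℕ∞ω} (hq : ContMDiffOn 𝓘(ℝ, ℝ) 𝓘(ℝ, E) n q J)
    (ht : t ∈ J) : ContDiffWithinAt ℝ n (fun s ↦ extChartAt 𝓘(ℝ, E) (q t) (q s)) J t := by
  have := (contMDiffWithinAt_iff_target.1 (hq t ht)).2
  rwa [contMDiffWithinAt_iff_contDiffWithinAt] at this

variable [IsManifold 𝓘(ℝ, E) ∞ M]

/-- Over the chart domain, the trivialisation of the tangent bundle around q(t) acts on fibres as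
`chartDeriv`. -/
theorem contDiffAlongOn_of_contMDiffOn {V : ∀ t, TangentSpace 𝓘(ℝ, E) (q t)}
    (hV : ContMDiffOn 𝓘(ℝ, ℝ) 𝓘(ℝ, E).tangent 1
      (fun t ↦ (⟨q t, V t⟩ : TangentBundle 𝓘(ℝ, E) M)) J) : ContDiffAlongOn q V J := by
  intro t ht
  have h := Bundle.contMDiffWithinAt_totalSpace.1 (hV t ht)
  have h2 := contMDiffWithinAt_iff_contDiffWithinAt.1 h.2
  have hs : ∀ᶠ s in 𝓝[J] t, q s ∈ (chartAt E (q t)).source :=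
    h.1.continuousWithinAt.eventually (chart_source_mem_nhds E (q t))
  have key : ∀ s, q s ∈ (chartAt E (q t)).source →
      chartDeriv (q t) (q s) (V s) =
        (trivializationAt E (TangentSpace 𝓘(ℝ, E)) (q t) ⟨q s, V s⟩).2 := by
    intro s hs
    rw [chartDeriv, ← Bundle.Trivialization.continuousLinearMapAt_apply_of_mem (R := ℝ) _ hs]
    exact (congrArg (fun L ↦ L (V s))
      (TangentBundle.continuousLinearMapAt_trivializationAt (I := 𝓘(ℝ, E)) hs)).symm
  refine h2.congr_of_eventuallyEq ?_ (key t (mem_chart_source E (q t)))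
  filter_upwards [hs] with s hs
  exact key s hs

theorem contDiffWithinAt_covector {α : ∀ t, TangentSpace 𝓘(ℝ, E) (q t) →L[ℝ] ℝ}
    (hα : ContMDiffOn 𝓘(ℝ, ℝ) (𝓘(ℝ, E).prod 𝓘(ℝ, E →L[ℝ] ℝ)) 1
        (fun t ↦ Bundle.TotalSpace.mk' (E →L[ℝ] ℝ)
          (E := fun x : M ↦ TangentSpace 𝓘(ℝ, E) x →L[ℝ] ℝ) (q t) (α t)) J) (ht : t ∈ J) :
    ContDiffWithinAt ℝ 1 (F := E →L[ℝ] ℝ)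
      (fun s ↦ (α s).comp (chartDeriv (q t) (q s)).inverse) J t := by
  have h := (contMDiffWithinAt_hom_bundle _).1 (hα t ht)
  have h2 := contMDiffWithinAt_iff_contDiffWithinAt.1 h.2
  have hs : ∀ᶠ s in 𝓝[J] t, q s ∈ (chartAt E (q t)).source :=
    h.1.continuousWithinAt.eventually (chart_source_mem_nhds E (q t))
  have key : ∀ s, q s ∈ (chartAt E (q t)).source →
      (α s).comp (chartDeriv (q t) (q s)).inverse =
        (α s).comp ((trivializationAt E (TangentSpace 𝓘(ℝ, E)) (q t)).symmL ℝ (q s)) := by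
    intro s hs
    have e : chartDeriv (q t) (q s) = _ :=
      (TangentBundle.continuousLinearMapAt_trivializationAt (I := 𝓘(ℝ, E)) hs).symm
    rw [e]
    congr 1
    refine ContinuousLinearMap.inverse_eq ?_ ?_
    · ext v
      exact (trivializationAt E (TangentSpace 𝓘(ℝ, E)) (q t)).continuousLinearMapAt_symmL hs v
    · ext v
      exact (trivializationAt E (TangentSpace 𝓘(ℝ, E)) (q t)).symmL_continuousLinearMapAt hs v
  refine h2.congr_of_eventuallyEq ?_ ?_
  · filter_upwards [hs] with s hs
    refine (key s hs).trans ?_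
    ext v
    simp [ContinuousLinearMap.inCoordinates]
  · refine (key t (mem_chart_source E (q t))).trans ?_
    ext v
    simp [ContinuousLinearMap.inCoordinates]

theorem derivWithin_chart (hq : ContMDiffOn 𝓘(ℝ, ℝ) 𝓘(ℝ, E) 1 q J) (hJ : UniqueDiffOn ℝ J)
    (c : M) {s : ℝ} (hs : s ∈ J) (hc : q s ∈ (extChartAt 𝓘(ℝ, E) c).source) :
    derivWithin (fun s ↦ extChartAt 𝓘(ℝ, E) c (q s)) J s =
      chartDeriv c (q s) (velocity q J s) := by
  have : IsManifold 𝓘(ℝ, E) 1 M := .of_le (n := ∞) (by simp)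
  rw [extChartAt_source] at hc
  have h1 := mdifferentiableAt_extChartAt (I := 𝓘(ℝ, E)) hc
  have h2 : MDifferentiableWithinAt 𝓘(ℝ, ℝ) 𝓘(ℝ, E) q J s :=
    (hq s hs).mdifferentiableWithinAt one_ne_zero
  have h3 := mfderiv_comp_mfderivWithin s h1 h2 (hJ s hs).uniqueMDiffWithinAt
  have h4 := congrArg (fun L : ℝ →L[ℝ] E ↦ L 1) (mfderivWithin_eq_fderivWithin.symm.trans h3)
  exact h4

theorem contDiffAlongOn_velocity (hq : ContMDiffOn 𝓘(ℝ, ℝ) 𝓘(ℝ, E) 2 q J)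
    (hJ : UniqueDiffOn ℝ J) : ContDiffAlongOn q (velocity (E := E) q J) J := by
  intro t ht
  have h1 := contDiffWithinAt_chart hq ht
  have hq1 : ContMDiffOn 𝓘(ℝ, ℝ) 𝓘(ℝ, E) 1 q J := hq.of_le (by norm_num)
  have h2 : ContDiffWithinAt ℝ 1
      (derivWithin (fun s ↦ extChartAt 𝓘(ℝ, E) (q t) (q s)) J) J t := by
    have := h1.fderivWithin_right hJ (m := 1) (by norm_num) ht
    exact this.clm_apply contDiffWithinAt_const
  refine h2.congr_of_eventuallyEq ?_
    (derivWithin_chart hq1 hJ (q t) ht (mem_extChartAt_source (q t))).symm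
  filter_upwards [eventually_mem_source hq1 ht, self_mem_nhdsWithin] with s hs hsJ
  exact (derivWithin_chart hq1 hJ (q t) hsJ hs).symm

end Curve

/-! ### The normal metric and its horizontal generators in charts. -/

section Metric

variable {E : Type*} [NormedAddCommGroup E] [NormedSpace ℝ E]
  {F : Type*} [NormedAddCommGroup F] [NormedSpace ℝ F]
  {G : Type*} [TopologicalSpace G] [ChartedSpace E G] [Group G] [LieGroup 𝓘(ℝ, E) ∞ G]
  {Q : Type*} [TopologicalSpace Q] [ChartedSpace F Q] [IsManifold 𝓘(ℝ, F) ∞ Q]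
  [MulAction G Q]
  (γ : Bundle.ContMDiffRiemannianMetric 𝓘(ℝ, E) ∞ E (TangentSpace 𝓘(ℝ, E) : G → Type _))
  {γQ : ∀ q : Q, TangentSpace 𝓘(ℝ, F) q →L[ℝ] TangentSpace 𝓘(ℝ, F) q →L[ℝ] ℝ}

/-- The inner product on the Lie algebra, as a bilinear form on the model space. -/
def algMetric : E →L[ℝ] E →L[ℝ] ℝ := γ.inner (1 : G)

theorem algMetric_symm (x y : E) : algMetric γ x y = algMetric γ y x := γ.symm 1 x y

theorem algMetric_pos (x : E) (hx : x ≠ 0) : 0 < algMetric γ x x := γ.pos 1 x hx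

theorem isInvertible_algMetric [FiniteDimensional ℝ E] : (algMetric γ).IsInvertible :=
  isInvertible_of_pos (algMetric_pos γ)

variable (G) in
/-- The bracket of the Lie algebra, on the model space. -/
def algBracket (ξ ζ : E) : E :=
  Bracket.bracket (L := GroupLieAlgebra 𝓘(ℝ, E) G) (M := GroupLieAlgebra 𝓘(ℝ, E) G) ξ ζ

theorem algMetric_adDagger [FiniteDimensional ℝ E] (ν κ : GroupLieAlgebra 𝓘(ℝ, E) G) (η : E) :
    algMetric γ (adDagger γ ν κ) η = algMetric γ κ (algBracket G ν η) :=
  congrArg (fun L : E →L[ℝ] ℝ ↦ L η)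
    ((isInvertible_algMetric γ).self_apply_inverse (adStar ν (flat γ κ)))

/-- The algebraic part of the covariant derivative of invariant vector fields. -/
def connTerm [FiniteDimensional ℝ E] (ξ ν : GroupLieAlgebra 𝓘(ℝ, E) G) :
    GroupLieAlgebra 𝓘(ℝ, E) G :=
  (1 / 2 : ℝ) • adDagger γ ξ ν + (1 / 2 : ℝ) • adDagger γ ν ξ - (1 / 2 : ℝ) • ⁅ξ, ν⁆

/-- This is the Koszul identity required of σ in `fderiv_add_christoffelMap`, with c the Lie
bracket. -/
theorem algMetric_connTerm [FiniteDimensional ℝ E] (ξ ν : GroupLieAlgebra 𝓘(ℝ, E) G) (η : E) :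
    2 * algMetric γ (connTerm γ ξ ν) η =
      algMetric γ ξ (algBracket G ν η) +
        algMetric γ ν (algBracket G ξ η) - algMetric γ (algBracket G ξ ν) η := by
  have e : ∀ a b c : E, algMetric γ ((1 / 2 : ℝ) • a + (1 / 2 : ℝ) • b - (1 / 2 : ℝ) • c) η =
      1 / 2 * algMetric γ a η + 1 / 2 * algMetric γ b η - 1 / 2 * algMetric γ c η := by
    intro a b c
    simp
  have := e (adDagger γ ξ ν) (adDagger γ ν ξ) (algBracket G ξ ν)
  rw [algMetric_adDagger, algMetric_adDagger] at this
  have h2 : algMetric γ (connTerm γ ξ ν) η = _ := this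
  rw [h2]
  ring

theorem connTerm_self [FiniteDimensional ℝ E] (ξ : GroupLieAlgebra 𝓘(ℝ, E) G) :
    connTerm γ ξ ξ = adDagger γ ξ ξ := by
  have h : (⁅ξ, ξ⁆ : GroupLieAlgebra 𝓘(ℝ, E) G) = 0 := by
    rw [GroupLieAlgebra.bracket_def]; simp
  have e : ∀ a : E, (1 / 2 : ℝ) • a + (1 / 2 : ℝ) • a - (1 / 2 : ℝ) • (0 : E) = a := by
    intro a
    rw [← add_smul]; norm_num
  rw [connTerm, h]
  exact e _

variable {γ}

/-- The chart differential is invertible, so it identifies the fibres of the generator map with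
those of its chart version, and the minimum is taken over the same set. -/
theorem isNormalForm_chartMetric (hγQ : IsNormalMetric γ γQ) {c : Q} {y : F}
    (hy : y ∈ (extChartAt 𝓘(ℝ, F) c).target) :
    IsNormalForm (algMetric γ) (chartGen E F G c y) (chartMetric γQ c y) := by
  have hs := (extChartAt 𝓘(ℝ, F) c).map_target hy
  have hi := isInvertible_chartDeriv hs
  have hset : ∀ (ξ : E) (v : F), chartGen E F G c y ξ = v ↔
      infGen (E := E) (F := F) (G := G) ((extChartAt 𝓘(ℝ, F) c).symm y) ξ =
        (chartDeriv (E := F) c ((extChartAt 𝓘(ℝ, F) c).symm y)).inverse v := fun ξ v ↦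
    ⟨fun h ↦ h ▸ (hi.inverse_apply_self _).symm,
      fun h ↦ (congrArg (chartDeriv (E := F) c _) h).trans (hi.self_apply_inverse v)⟩
  refine ⟨fun v w ↦ hγQ.symm _ _ _, fun v ↦ ?_⟩
  obtain ⟨⟨ξ, h1, h2⟩, h3⟩ := hγQ.isLeast _
    ((chartDeriv (E := F) c ((extChartAt 𝓘(ℝ, F) c).symm y)).inverse v)
  refine ⟨⟨ξ, (hset ξ v).2 h1, h2⟩, ?_⟩
  rintro r ⟨ζ, h4, h5⟩
  exact h3 ⟨ζ, (hset ζ v).1 h4, h5⟩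

theorem isHor_chartGen_iff {c q : Q} (hq : q ∈ (extChartAt 𝓘(ℝ, F) c).source)
    (ξ : GroupLieAlgebra 𝓘(ℝ, E) G) :
    IsHor (algMetric γ) (chartGen E F G c (extChartAt 𝓘(ℝ, F) c q)) ξ ↔ ξ ∈ horiz F γ q := by
  have hi := isInvertible_chartDeriv hq
  refine forall_congr' fun η ↦ imp_congr_left ?_
  exact (Eq.congr_left (chartGen_extChartAt hq η)).trans (map_eq_zero_iff _ hi.injective)

variable [FiniteDimensional ℝ E] [FiniteDimensional ℝ F]

omit [FiniteDimensional ℝ F] [IsManifold 𝓘(ℝ, F) ∞ Q] in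
theorem horizontal_iff_horGen (hγQ : IsNormalMetric γ γQ) (q : Q) (v : TangentSpace 𝓘(ℝ, F) q)
    (ξ : GroupLieAlgebra 𝓘(ℝ, E) G) :
    (ξ ∈ horiz F γ q ∧ v = infGen (F := F) q ξ) ↔ ξ = horGen γ γQ q v := by
  have h : IsNormalForm (F := F) (algMetric γ) (infGen (E := E) (F := F) (G := G) q) (γQ q) :=
    ⟨hγQ.symm q, hγQ.isLeast q⟩
  exact h.isHor_iff (algMetric_symm γ) (algMetric_pos γ) v ξ

variable [ContMDiffSMul 𝓘(ℝ, E) 𝓘(ℝ, F) ∞ G Q]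

theorem contDiffAt_chartMetric (hγQ : IsNormalMetric γ γQ) {c : Q} {y : F}
    (hy : y ∈ (extChartAt 𝓘(ℝ, F) c).target) : ContDiffAt ℝ 1 (chartMetric γQ c) y := by
  refine contDiffAt_of_isNormalForm (algMetric_symm γ) (algMetric_pos γ) 
    (contDiffAt_chartGen (E := E) (G := G) hy) ?_
  filter_upwards [(isOpen_extChartAt_target c).mem_nhds hy] with x hx
  exact isNormalForm_chartMetric hγQ hx

/-- The covariant derivative of horizontal generators, in a chart. -/
theorem fderiv_chartGen_add_christoffel (hγQ : IsNormalMetric γ γQ) {q : Q}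
    {ξ ν : GroupLieAlgebra 𝓘(ℝ, E) G} (hξ : ξ ∈ horiz F γ q) (hν : ν ∈ horiz F γ q) :
    fderiv ℝ (chartGen E F G q) (extChartAt 𝓘(ℝ, F) q q)
        (chartGen E F G q (extChartAt 𝓘(ℝ, F) q q) ξ) ν +
      christoffel γQ q (extChartAt 𝓘(ℝ, F) q q)
        (chartGen E F G q (extChartAt 𝓘(ℝ, F) q q) ξ)
        (chartGen E F G q (extChartAt 𝓘(ℝ, F) q q) ν) =
      chartGen E F G q (extChartAt 𝓘(ℝ, F) q q) (connTerm γ ξ ν) := by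
  have hy := mem_extChartAt_target (I := 𝓘(ℝ, F)) q
  refine fderiv_add_christoffelMap (k := algMetric γ) (algMetric_symm γ) (algMetric_pos γ)
    (contDiffAt_chartGen hy) ?_
    (c := algBracket G) (fun ξ ζ ↦ fderiv_chartGen_comm q ξ ζ)
    ((isHor_chartGen_iff (mem_extChartAt_source q) ξ).2 hξ)
    ((isHor_chartGen_iff (mem_extChartAt_source q) ν).2 hν)
    (algMetric_connTerm γ ξ ν)
  filter_upwards [extChartAt_target_mem_nhds q] with x hx
  exact isNormalForm_chartMetric hγQ hx

variable {q : ℝ → Q} {J : Set ℝ} {t : ℝ} {V : ∀ t, TangentSpace 𝓘(ℝ, F) (q t)}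
  {ξ ν : ℝ → GroupLieAlgebra 𝓘(ℝ, E) G}

omit [FiniteDimensional ℝ E] [FiniteDimensional ℝ F] in
theorem contDiffWithinAt_chartGen (hq : ContMDiffOn 𝓘(ℝ, ℝ) 𝓘(ℝ, F) 1 q J) (ht : t ∈ J) :
    ContDiffWithinAt ℝ 1
      (fun s ↦ chartGen E F G (q t) (extChartAt 𝓘(ℝ, F) (q t) (q s))) J t :=
  ContDiffAt.comp_contDiffWithinAt (g := chartGen E F G (q t)) t
    (contDiffAt_chartGen (mem_extChartAt_target (q t)))
    (contDiffWithinAt_chart hq ht)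

/-- The horizontal generator of a `C^1` vector field along a curve is `C^1`. -/
theorem contDiffOn_horizontal (hγQ : IsNormalMetric γ γQ)
    (hq : ContMDiffOn 𝓘(ℝ, ℝ) 𝓘(ℝ, F) 1 q J) (hV : ContDiffAlongOn q V J)
    (hν : ∀ t ∈ J, ν t ∈ horiz F γ (q t) ∧ V t = infGen (F := F) (q t) (ν t)) :
    ContDiffOn ℝ 1 (F := E) ν J := by
  intro t ht
  have hA := contDiffWithinAt_chartGen (E := E) (G := G) hq ht
  have hg : ContDiffWithinAt ℝ 1
      (fun s ↦ chartMetric γQ (q t) (extChartAt 𝓘(ℝ, F) (q t) (q s))) J t :=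
    ContDiffAt.comp_contDiffWithinAt (g := chartMetric γQ (q t)) t
      (contDiffAt_chartMetric hγQ (mem_extChartAt_target (q t)))
      (contDiffWithinAt_chart hq ht)
  -- The horizontal lift k⁻¹ A* g V is an explicit expression in C¹ data, which is where the
  -- regularity of ν comes from.
  have key : ∀ s ∈ J, q s ∈ (extChartAt 𝓘(ℝ, F) (q t)).source →
      ν s = (algMetric γ).inverse
        (((chartMetric γQ (q t) (extChartAt 𝓘(ℝ, F) (q t) (q s)))
          (chartDeriv (q t) (q s) (V s))).comp
            (chartGen E F G (q t) (extChartAt 𝓘(ℝ, F) (q t) (q s)))) := by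
    intro s hs hqs
    have hn := isNormalForm_chartMetric hγQ ((extChartAt 𝓘(ℝ, F) (q t)).map_source hqs)
    refine (hn.isHor_iff (algMetric_symm γ) (algMetric_pos γ) _ _).1 ⟨?_, ?_⟩
    · exact (isHor_chartGen_iff hqs _).2 (hν s hs).1
    · rw [chartGen_extChartAt hqs, (hν s hs).2]
  have h : ContDiffWithinAt ℝ 1 (fun s ↦ (algMetric γ).inverse
        (((chartMetric γQ (q t) (extChartAt 𝓘(ℝ, F) (q t) (q s)))
          (chartDeriv (q t) (q s) (V s))).comp
            (chartGen E F G (q t) (extChartAt 𝓘(ℝ, F) (q t) (q s))))) J t :=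
    contDiffWithinAt_const.clm_apply ((hg.clm_apply (hV t ht)).clm_comp hA)
  refine h.congr_of_eventuallyEq ?_ (key t ht (mem_extChartAt_source (q t)))
  filter_upwards [eventually_mem_source hq ht, self_mem_nhdsWithin] with s hs hsJ
  exact key s hsJ hs

omit [FiniteDimensional ℝ E] [FiniteDimensional ℝ F] in
-- Product rule for V = A(x(s)) ν(s) in the chart, with ẋ = Aξ. Horizontality plays no role at this
-- stage.
theorem hasDerivWithinAt_chart_infGen (hq : ContMDiffOn 𝓘(ℝ, ℝ) 𝓘(ℝ, F) 1 q J)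
    (hJ : UniqueDiffOn ℝ J) (ht : t ∈ J)
    (hν : DifferentiableWithinAt ℝ (F := E) ν J t)
    (hξ : velocity (E := F) q J t = infGen (F := F) (q t) (ξ t))
    (hV : ∀ t ∈ J, V t = infGen (F := F) (q t) (ν t)) :
    HasDerivWithinAt (F := F) (fun s ↦ chartDeriv (q t) (q s) (V s))
      (chartGen E F G (q t) (extChartAt 𝓘(ℝ, F) (q t) (q t)) (derivWithin (F := E) ν J t) +
        fderiv ℝ (chartGen E F G (q t)) (extChartAt 𝓘(ℝ, F) (q t) (q t))
          (chartGen E F G (q t) (extChartAt 𝓘(ℝ, F) (q t) (q t)) (ξ t)) (ν t)) J t := by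
  have hx : HasDerivWithinAt (fun s ↦ extChartAt 𝓘(ℝ, F) (q t) (q s))
      (chartGen E F G (q t) (extChartAt 𝓘(ℝ, F) (q t) (q t)) (ξ t)) J t := by
    have := ((contDiffWithinAt_chart hq ht).differentiableWithinAt one_ne_zero).hasDerivWithinAt
    rw [derivWithin_chart hq hJ (q t) ht (mem_extChartAt_source (q t)), hξ] at this
    rwa [chartGen_extChartAt (mem_extChartAt_source (q t))]
  have hA := ((contDiffAt_chartGen (E := E) (G := G)
    (mem_extChartAt_target (I := 𝓘(ℝ, F)) (q t))).differentiableAt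
      one_ne_zero).hasFDerivAt.comp_hasDerivWithinAt t hx
  have h := hA.clm_apply hν.hasDerivWithinAt
  have key : ∀ s ∈ J, q s ∈ (extChartAt 𝓘(ℝ, F) (q t)).source →
      chartDeriv (q t) (q s) (V s) =
        chartGen E F G (q t) (extChartAt 𝓘(ℝ, F) (q t) (q s)) (ν s) := by
    intro s hs hqs
    rw [chartGen_extChartAt hqs, hV s hs]
  rw [add_comm]
  refine h.congr_of_eventuallyEq ?_ (key t ht (mem_extChartAt_source (q t)))
  filter_upwards [eventually_mem_source hq ht, self_mem_nhdsWithin] with s hs hsJ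
  exact key s hsJ hs

end Metric

/-! ### Covariant derivatives along curves in terms of generators. -/

section Covariant

variable {E : Type*} [NormedAddCommGroup E] [NormedSpace ℝ E]
  {F : Type*} [NormedAddCommGroup F] [NormedSpace ℝ F]
  {G : Type*} [TopologicalSpace G] [ChartedSpace E G] [Group G] [LieGroup 𝓘(ℝ, E) ∞ G]
  {Q : Type*} [TopologicalSpace Q] [ChartedSpace F Q] [IsManifold 𝓘(ℝ, F) ∞ Q]
  [MulAction G Q] [ContMDiffSMul 𝓘(ℝ, E) 𝓘(ℝ, F) ∞ G Q]
  {γ : Bundle.ContMDiffRiemannianMetric 𝓘(ℝ, E) ∞ E (TangentSpace 𝓘(ℝ, E) : G → Type _)}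
  {γQ : ∀ q : Q, TangentSpace 𝓘(ℝ, F) q →L[ℝ] TangentSpace 𝓘(ℝ, F) q →L[ℝ] ℝ}
  {q : ℝ → Q} {J : Set ℝ} {t : ℝ} {V : ∀ t, TangentSpace 𝓘(ℝ, F) (q t)}
  {ξ ν : ℝ → GroupLieAlgebra 𝓘(ℝ, E) G}

theorem inverse_chartDeriv_self (c : Q) (v : F) : (chartDeriv (E := F) c c).inverse v = v := by
  have h := chartDeriv_self (E := F) c
  have h2 : (ContinuousLinearMap.id ℝ F).inverse = ContinuousLinearMap.id ℝ F :=
    ContinuousLinearMap.inverse_id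
  exact congrArg (fun L : F →L[ℝ] F ↦ L v) ((congrArg ContinuousLinearMap.inverse h).trans h2)

omit [LieGroup 𝓘(ℝ, E) ∞ G] [ContMDiffSMul 𝓘(ℝ, E) 𝓘(ℝ, F) ∞ G Q] in
theorem chartGen_self (c : Q) (η : E) :
    chartGen E F G c (extChartAt 𝓘(ℝ, F) c c) η = infGen (E := E) (F := F) (G := G) c η :=
  (chartGen_extChartAt (mem_extChartAt_source c) η).trans
    (congrArg (fun L : F →L[ℝ] F ↦ L (infGen (E := E) (F := F) (G := G) c η)) (chartDeriv_self c))

theorem covDerivAlong_eq_chart (hq : ContMDiffOn 𝓘(ℝ, ℝ) 𝓘(ℝ, F) 1 q J)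
    (hJ : UniqueDiffOn ℝ J) (ht : t ∈ J)
    (hν : DifferentiableWithinAt ℝ (F := E) ν J t)
    (hξ : velocity (E := F) q J t = infGen (F := F) (q t) (ξ t))
    (hV : ∀ t ∈ J, V t = infGen (F := F) (q t) (ν t)) :
    covDerivAlong γQ q V J t =
      (chartGen E F G (q t) (extChartAt 𝓘(ℝ, F) (q t) (q t)) (derivWithin (F := E) ν J t) +
        fderiv ℝ (chartGen E F G (q t)) (extChartAt 𝓘(ℝ, F) (q t) (q t))
          (chartGen E F G (q t) (extChartAt 𝓘(ℝ, F) (q t) (q t)) (ξ t)) (ν t) +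
        christoffel γQ (q t) (extChartAt 𝓘(ℝ, F) (q t) (q t))
          (chartGen E F G (q t) (extChartAt 𝓘(ℝ, F) (q t) (q t)) (ξ t))
          (chartGen E F G (q t) (extChartAt 𝓘(ℝ, F) (q t) (q t)) (ν t)) : F) := by
  refine (inverse_chartDeriv_self (q t) _).trans ?_
  have h1 := (hasDerivWithinAt_chart_infGen hq hJ ht hν hξ hV).derivWithin (hJ t ht)
  have h2 : derivWithin (fun s ↦ extChartAt 𝓘(ℝ, F) (q t) (q s)) J t =
      chartGen E F G (q t) (extChartAt 𝓘(ℝ, F) (q t) (q t)) (ξ t) := by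
    rw [derivWithin_chart hq hJ (q t) ht (mem_extChartAt_source (q t)), hξ,
      chartGen_extChartAt (mem_extChartAt_source (q t))]
  have h3 : chartDeriv (q t) (q t) (V t) =
      chartGen E F G (q t) (extChartAt 𝓘(ℝ, F) (q t) (q t)) (ν t) := by
    rw [chartGen_extChartAt (mem_extChartAt_source (q t)), hV t ht]
  exact congrArg₂ (fun a b : F ↦ a + b) h1 (congrArg₂ (fun u v : F ↦
    christoffel γQ (q t) (extChartAt 𝓘(ℝ, F) (q t) (q t)) u v) h2 h3)

omit [LieGroup 𝓘(ℝ, E) ∞ G] [ContMDiffSMul 𝓘(ℝ, E) 𝓘(ℝ, F) ∞ G Q] in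
theorem chartGen_self_add (c : Q) (a b : E) :
    chartGen E F G c (extChartAt 𝓘(ℝ, F) c c) a + chartGen E F G c (extChartAt 𝓘(ℝ, F) c c) b =
      infGen (E := E) (F := F) (G := G) c (a + b : E) := by
  rw [← map_add]
  exact chartGen_self c (a + b)

omit [LieGroup 𝓘(ℝ, E) ∞ G] [IsManifold 𝓘(ℝ, F) ∞ Q] [MulAction G Q]
  [ContMDiffSMul 𝓘(ℝ, E) 𝓘(ℝ, F) ∞ G Q] in
theorem christoffel_zero_right (c : Q) (y u : F) : christoffel γQ c y u 0 = 0 := by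
  simp [christoffel, christoffelMap]

/-- The Christoffel term is linear in the value of the field, which is zero at c; only the plain
derivative survives. -/
theorem covDeriv_vertical {c : Q} (η : E)
    (hη : infGen (E := E) (F := F) (G := G) c η = 0) (v : TangentSpace 𝓘(ℝ, F) c) :
    covDeriv γQ (fun x ↦ infGen (E := E) (F := F) (G := G) x η) c v =
      (fderiv ℝ (chartGen E F G c) (extChartAt 𝓘(ℝ, F) c c) v η : F) := by
  refine (inverse_chartDeriv_self c _).trans ?_
  have h1 : chartGen E F G c (extChartAt 𝓘(ℝ, F) c c) η = 0 :=
    (chartGen_self (E := E) (F := F) (G := G) c η).trans hη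
  have h2 : ∀ u : F, fderiv ℝ (fun y ↦ chartGen E F G c y η) (extChartAt 𝓘(ℝ, F) c c) u +
      christoffel γQ c (extChartAt 𝓘(ℝ, F) c c) u
        (chartGen E F G c (extChartAt 𝓘(ℝ, F) c c) η) =
      fderiv ℝ (chartGen E F G c) (extChartAt 𝓘(ℝ, F) c c) u η := by
    intro u
    have hA := (contDiffAt_chartGen (E := E) (G := G)
      (mem_extChartAt_target (I := 𝓘(ℝ, F)) c)).differentiableAt one_ne_zero
    rw [h1, christoffel_zero_right, add_zero, fderiv_clm_apply hA (differentiableAt_const η)]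
    simp
  have h3 : chartDeriv c c v = v := congrArg (fun L : F →L[ℝ] F ↦ L v) (chartDeriv_self c)
  exact (h2 _).trans (congrArg (fun u : F ↦ fderiv ℝ (chartGen E F G c) _ u η) h3)

variable [FiniteDimensional ℝ E] [FiniteDimensional ℝ F]

/-- The covariant derivative along a curve in terms of horizontal generators. -/
theorem covDerivAlong_horizontal (hγQ : IsNormalMetric γ γQ)
    (hq : ContMDiffOn 𝓘(ℝ, ℝ) 𝓘(ℝ, F) 1 q J)
    (hJ : UniqueDiffOn ℝ J) (ht : t ∈ J)
    (hν : DifferentiableWithinAt ℝ (F := E) ν J t)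
    (hξ : velocity (E := F) q J t = infGen (F := F) (q t) (ξ t))
    (hV : ∀ t ∈ J, V t = infGen (F := F) (q t) (ν t))
    (hξh : ξ t ∈ horiz F γ (q t)) (hνh : ν t ∈ horiz F γ (q t)) :
    covDerivAlong γQ q V J t =
      infGen (F := F) (q t) (derivWithin ν J t + connTerm γ (ξ t) (ν t)) := by
  refine (covDerivAlong_eq_chart hq hJ ht hν hξ hV).trans ?_
  rw [add_assoc, fderiv_chartGen_add_christoffel hγQ hξh hνh]
  exact chartGen_self_add (E := E) (F := F) (G := G) (q t) _ _

/-- The covariant acceleration in terms of an arbitrary generator of the curve. -/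
theorem covDerivAlong_velocity (hγQ : IsNormalMetric γ γQ)
    (hq : ContMDiffOn 𝓘(ℝ, ℝ) 𝓘(ℝ, F) 1 q J)
    (hJ : UniqueDiffOn ℝ J) (ht : t ∈ J)
    (hξ : DifferentiableWithinAt ℝ (F := E) ξ J t)
    (hv : ∀ t ∈ J, velocity (E := F) q J t = infGen (F := F) (q t) (ξ t)) :
    covDerivAlong γQ q (velocity (E := F) q J) J t =
      infGen (F := F) (q t) (derivWithin ξ J t
        + adDagger γ (horProj F γ (q t) (ξ t)) (horProj F γ (q t) (ξ t)))
      + covDeriv γQ (fun x ↦ infGen (F := F) x (vertProj F γ (q t) (ξ t))) (q t)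
        (velocity (E := F) q J t) := by
  set η := horProj F γ (q t) (ξ t) with hη
  set ζ := vertProj F γ (q t) (ξ t) with hζ
  have hηh : η ∈ horiz F γ (q t) := Submodule.projection_apply_mem _ _
  have hζv : ζ ∈ vert E F G (q t) := Submodule.projection_apply_mem _ _
  have hζ0 : infGen (F := F) (q t) ζ = 0 := hζv
  have hsum : ξ t = η + ζ :=
    (Submodule.projection_add_projection_eq_self (isCompl_horiz_vert F γ (q t)) (ξ t)).symm
  set y := extChartAt 𝓘(ℝ, F) (q t) (q t) with hy
  have hζ1 : chartGen E F G (q t) y ζ = 0 := (chartGen_self (E := E) (F := F) (G := G) (q t) ζ).trans hζ0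
  have hAξ : chartGen E F G (q t) y (ξ t) = chartGen E F G (q t) y η := by
    have h : chartGen E F G (q t) y (ξ t) =
      chartGen E F G (q t) y η + chartGen E F G (q t) y ζ := by rw [hsum]; exact map_add _ _ _
    rw [h, hζ1, add_zero]
  have hvel : velocity (E := F) q J t = chartGen E F G (q t) y (ξ t) :=
    (hv t ht).trans (chartGen_self (E := E) (F := F) (G := G) (q t) _).symm
  -- Both parts are differentiated along the same velocity Aξ = Aη. The η term joins the Christoffel
  -- term to give ad†_η η, the ζ term is the covariant derivative of the vertical generator.
  have hD : fderiv ℝ (chartGen E F G (q t)) y (chartGen E F G (q t) y (ξ t)) (ξ t) =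
      fderiv ℝ (chartGen E F G (q t)) y (chartGen E F G (q t) y η) η +
      fderiv ℝ (chartGen E F G (q t)) y (chartGen E F G (q t) y (ξ t)) ζ := by
    rw [← hAξ]
    exact (congrArg _ hsum).trans (map_add _ _ _)
  have hΓ := fderiv_chartGen_add_christoffel hγQ hηh hηh
  rw [← hy] at hΓ
  have h1 := covDerivAlong_eq_chart (γQ := γQ) hq hJ ht hξ (hv t ht) hv
  refine h1.trans ?_
  rw [← hy, hD, hAξ]
  have h2 : covDeriv γQ (fun x ↦ infGen (F := F) x ζ) (q t) (velocity (E := F) q J t) =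
      (fderiv ℝ (chartGen E F G (q t)) y (chartGen E F G (q t) y η) ζ : F) := by
    refine (covDeriv_vertical (E := E) (F := F) (G := G) ζ hζ0 _).trans ?_
    exact congrArg (fun u : F ↦ fderiv ℝ (chartGen E F G (q t)) y u ζ) (hvel.trans hAξ)
  have h3 := chartGen_self_add (E := E) (F := F) (G := G) (q t)
    (derivWithin (F := E) ξ J t) (adDagger γ η η)
  rw [connTerm_self] at hΓ
  rw [← hy, ← hΓ] at h3
  refine Eq.trans ?_ (congrArg₂ (fun a b : F ↦ a + b) h3 h2.symm)
  abel

end Covariant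

/-! ### The group as a homogeneous space of itself. -/

section LieGroup

variable {E : Type*} [NormedAddCommGroup E] [NormedSpace ℝ E]
  {G : Type*} [TopologicalSpace G] [ChartedSpace E G] [Group G] [LieGroup 𝓘(ℝ, E) ∞ G]
  {γ : Bundle.ContMDiffRiemannianMetric 𝓘(ℝ, E) ∞ E (TangentSpace 𝓘(ℝ, E) : G → Type _)}

theorem inner_infGen (hγ : IsRightInvariant γ) (g : G) (ξ ζ : E) :
    γ.inner g (infGen (E := E) (F := E) (G := G) g ξ) (infGen (E := E) (F := E) (G := G) g ζ) =
      algMetric γ ξ ζ := by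
  -- All tangent spaces are the model space, so a non-dependent version of the metric allows the
  -- base point 1 * g to be replaced by g.
  let f : G → E → E → ℝ := fun x u v ↦ γ.inner x u v
  have h := hγ g 1 ξ ζ
  exact (congrArg (fun x ↦ f x (infGen (E := E) (F := E) (G := G) g ξ)
    (infGen (E := E) (F := E) (G := G) g ζ)) (one_mul g).symm).trans h

theorem rightTransInv_infGen (g : G) (ξ : E) :
    rightTransInv (E := E) g (infGen (E := E) (F := E) (G := G) g ξ) = ξ := by
  have h1 : MDifferentiableAt 𝓘(ℝ, E) 𝓘(ℝ, E) (fun k : G ↦ k * g) 1 :=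
    (contMDiff_mul_right (n := ∞)).mdifferentiable (by simp) 1
  have h2 : MDifferentiableAt 𝓘(ℝ, E) 𝓘(ℝ, E) (fun k : G ↦ k * g⁻¹) ((fun k : G ↦ k * g) 1) :=
    (contMDiff_mul_right (n := ∞)).mdifferentiable (by simp) _
  have h3 := mfderiv_comp (1 : G) h2 h1
  have h4 : (fun k : G ↦ k * g⁻¹) ∘ (fun k : G ↦ k * g) = id := by ext; simp
  rw [h4, mfderiv_id] at h3
  have h5 := congrArg (fun L : E →L[ℝ] E ↦ L ξ) h3.symm
  refine Eq.trans ?_ h5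
  exact congrArg (fun x : G ↦ (mfderiv 𝓘(ℝ, E) 𝓘(ℝ, E) (fun k : G ↦ k * g⁻¹) x : E →L[ℝ] E)
    (mfderiv 𝓘(ℝ, E) 𝓘(ℝ, E) (fun k : G ↦ k * g) 1 ξ)) (one_mul g).symm

theorem infGen_injective (g : G) :
    Function.Injective (infGen (E := E) (F := E) (G := G) g) :=
  Function.LeftInverse.injective (rightTransInv_infGen (E := E) g)

theorem infGen_bijective [FiniteDimensional ℝ E] (g : G) :
    Function.Bijective (infGen (E := E) (F := E) (G := G) g) := by
  refine ⟨infGen_injective g, ?_⟩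
  let L : E →ₗ[ℝ] E := (infGen (E := E) (F := E) (G := G) g : E →L[ℝ] E).toLinearMap
  exact (LinearMap.injective_iff_surjective (f := L)).1 (infGen_injective g)

/-- The generator map is bijective, so each minimum is over a single point, and right-invariance
gives its value. -/
theorem isNormalMetric_inner [FiniteDimensional ℝ E] (hγ : IsRightInvariant γ) :
    IsNormalMetric (Q := G) γ γ.inner := by
  refine ⟨γ.symm, fun g v ↦ ?_⟩
  obtain ⟨ξ, rfl⟩ := (infGen_bijective g).2 v
  refine ⟨⟨ξ, rfl, inner_infGen hγ g ξ ξ⟩, ?_⟩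
  rintro r ⟨ζ, h, rfl⟩
  rw [infGen_injective g h]
  exact (inner_infGen hγ g ξ ξ).le

theorem mem_horiz_group (g : G) (ξ : GroupLieAlgebra 𝓘(ℝ, E) G) :
    ξ ∈ horiz E γ g := by
  intro η hη
  have h : infGen (E := E) (F := E) (G := G) g η = infGen (E := E) (F := E) (G := G) g 0 := by
    rw [map_zero]; exact hη
  rw [infGen_injective (E := E) g h, map_zero]

end LieGroup

/-! ### Covector fields along curves in the group. -/

section Covector

theorem chartMetric_extChartAt {E : Type*} [NormedAddCommGroup E] [NormedSpace ℝ E]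
    {M : Type*} [TopologicalSpace M] [ChartedSpace E M]
    (γ : ∀ x : M, TangentSpace 𝓘(ℝ, E) x →L[ℝ] TangentSpace 𝓘(ℝ, E) x →L[ℝ] ℝ) {c x : M}
    (hx : x ∈ (extChartAt 𝓘(ℝ, E) c).source) (u v : E) :
    chartMetric γ c (extChartAt 𝓘(ℝ, E) c x) u v =
      γ x ((chartDeriv (E := E) c x).inverse u) ((chartDeriv (E := E) c x).inverse v) := by
  have h : ∀ z, z = x → γ z ((chartDeriv (E := E) c z).inverse u)
      ((chartDeriv (E := E) c z).inverse v) =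
      γ x ((chartDeriv (E := E) c x).inverse u) ((chartDeriv (E := E) c x).inverse v) := by
    rintro z rfl; rfl
  exact h _ ((extChartAt 𝓘(ℝ, E) c).left_inv hx)

variable {E : Type*} [NormedAddCommGroup E] [NormedSpace ℝ E] [FiniteDimensional ℝ E]
  {G : Type*} [TopologicalSpace G] [ChartedSpace E G] [Group G] [LieGroup 𝓘(ℝ, E) ∞ G]
  {γ : Bundle.ContMDiffRiemannianMetric 𝓘(ℝ, E) ∞ E (TangentSpace 𝓘(ℝ, E) : G → Type _)}
  {g : ℝ → G} {J : Set ℝ} {t : ℝ} {α : ∀ t, TangentSpace 𝓘(ℝ, E) (g t) →L[ℝ] ℝ}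
  {ξ : ℝ → GroupLieAlgebra 𝓘(ℝ, E) G} {μ : ℝ → GroupLieAlgebra 𝓘(ℝ, E) G →L[ℝ] ℝ}

omit [FiniteDimensional ℝ E] in
theorem contDiffOn_pullback_covector (hg : ContMDiffOn 𝓘(ℝ, ℝ) 𝓘(ℝ, E) 1 g J)
    (hα : ContMDiffOn 𝓘(ℝ, ℝ) (𝓘(ℝ, E).prod 𝓘(ℝ, E →L[ℝ] ℝ)) 1
        (fun t ↦ Bundle.TotalSpace.mk' (E →L[ℝ] ℝ)
          (E := fun x : G ↦ TangentSpace 𝓘(ℝ, E) x →L[ℝ] ℝ) (g t) (α t)) J)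
    (hμ : ∀ t ∈ J, μ t = (α t).comp (rightTrans (g t))) :
    ContDiffOn ℝ 1 (F := E →L[ℝ] ℝ) μ J := by
  intro t ht
  have hA := contDiffWithinAt_chartGen (E := E) (G := G) hg ht
  have ha := contDiffWithinAt_covector hα ht
  have key : ∀ s ∈ J, g s ∈ (extChartAt 𝓘(ℝ, E) (g t)).source →
      (μ s : E →L[ℝ] ℝ) = ((α s).comp (chartDeriv (g t) (g s)).inverse : E →L[ℝ] ℝ).comp
        (chartGen E E G (g t) (extChartAt 𝓘(ℝ, E) (g t) (g s))) := by
    intro s hs hgs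
    ext ζ
    have hi := isInvertible_chartDeriv hgs
    refine (congrArg (fun L : E →L[ℝ] ℝ ↦ L ζ) (hμ s hs)).trans (congrArg (α s) ?_)
    exact (hi.inverse_apply_self _).symm.trans
      (congrArg (chartDeriv (g t) (g s)).inverse (chartGen_extChartAt hgs ζ).symm)
  have h := ha.clm_comp hA
  refine h.congr_of_eventuallyEq ?_ (key t ht (mem_extChartAt_source (g t)))
  filter_upwards [eventually_mem_source hg ht, self_mem_nhdsWithin] with s hs hsJ
  exact key s hsJ hs

/-- With ν = μ^♯ the covector field is α = γ(V, ·) for V = ν_G. Metric compatibility gives Dα/Dt =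
γ(DV/Dt, ·), and right-invariance turns this into the pairing of ν̇ + `connTerm` with ζ, where w =
ζ_G. -/
theorem covDerivAlongCovector_eq (hγ : IsRightInvariant γ)
    (hg : ContMDiffOn 𝓘(ℝ, ℝ) 𝓘(ℝ, E) 1 g J) (hJ : UniqueDiffOn ℝ J) (ht : t ∈ J)
    (hξ : velocity (E := E) g J t = infGen (F := E) (g t) (ξ t))
    (hμ : ∀ t ∈ J, μ t = (α t).comp (rightTrans (g t)))
    (hμd : DifferentiableWithinAt ℝ (F := E →L[ℝ] ℝ) μ J t) (w : TangentSpace 𝓘(ℝ, E) (g t)) :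
    covDerivAlongCovector γ.inner g α J t w =
      (derivWithin μ J t - (1 / 2 : ℝ) • flat γ ⁅ξ t, sharp γ (μ t)⁆
        + (1 / 2 : ℝ) • adStar (sharp γ (μ t)) (flat γ (ξ t))
        + (1 / 2 : ℝ) • adStar (ξ t) (μ t)).comp (rightTransInv (g t)) w := by
  have hγQ := isNormalMetric_inner hγ
  have hk := isInvertible_algMetric γ
  revert w
  set c := g t with hc
  intro w
  set y := extChartAt 𝓘(ℝ, E) c c with hy
  have hys : y ∈ (extChartAt 𝓘(ℝ, E) c).target := mem_extChartAt_target c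
  have hcs : c ∈ (extChartAt 𝓘(ℝ, E) c).source := mem_extChartAt_source c
  let ν : ℝ → E := fun s ↦ (algMetric γ).inverse (μ s)
  have hkν : ∀ s, algMetric γ (ν s) = μ s := fun s ↦ hk.self_apply_inverse _
  have hνd : HasDerivWithinAt ν ((algMetric γ).inverse (derivWithin (F := E →L[ℝ] ℝ) μ J t)) J t :=
    (algMetric γ).inverse.hasFDerivAt.comp_hasDerivWithinAt t hμd.hasDerivWithinAt
  let V : ∀ s, TangentSpace 𝓘(ℝ, E) (g s) := fun s ↦ infGen (E := E) (F := E) (G := G) (g s) (ν s)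
  have hV := hasDerivWithinAt_chart_infGen (E := E) (G := G) (V := V) (ν := ν) hg hJ ht
    hνd.differentiableWithinAt hξ (fun _ _ ↦ rfl)
  rw [hνd.derivWithin (hJ t ht), ← hc, ← hy] at hV
  have hαV : ∀ s ∈ J, ∀ u : E, α s u = γ.inner (g s) (V s) u := by
    intro s hs u
    obtain ⟨ζ, rfl⟩ := (infGen_bijective (E := E) (g s)).2 u
    refine Eq.trans ?_ (inner_infGen hγ (g s) (ν s) ζ).symm
    rw [hkν, hμ s hs]
    rfl
  let x : ℝ → E := fun s ↦ extChartAt 𝓘(ℝ, E) c (g s)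
  let v : ℝ → E := fun s ↦ chartDeriv c (g s) (V s)
  let a : ℝ → E →L[ℝ] ℝ := fun s ↦ (α s).comp (chartDeriv c (g s)).inverse
  have ha : ∀ s ∈ J, g s ∈ (extChartAt 𝓘(ℝ, E) c).source →
      a s = chartMetric γ.inner c (x s) (v s) := by
    intro s hs hgs
    ext u
    have hi := isInvertible_chartDeriv hgs
    refine (hαV s hs _).trans ?_
    refine Eq.trans ?_ (chartMetric_extChartAt γ.inner hgs _ _).symm
    rw [hi.inverse_apply_self]
    rfl
  set A := chartGen E E G c with hA
  have hx' : derivWithin x J t = A y (ξ t) := by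
    refine (derivWithin_chart hg hJ c ht hcs).trans ?_
    rw [chartGen_extChartAt hcs, ← hξ]
  have hx : HasDerivWithinAt x (A y (ξ t)) J t := by
    rw [← hx']
    exact ((contDiffWithinAt_chart hg ht).differentiableWithinAt one_ne_zero).hasDerivWithinAt
  have hgd := (contDiffAt_chartMetric hγQ hys).differentiableAt one_ne_zero
  have hgx : HasDerivWithinAt (fun s ↦ chartMetric γ.inner c (x s))
      (fderiv ℝ (chartMetric γ.inner c) y (A y (ξ t))) J t :=
    HasFDerivAt.comp_hasDerivWithinAt (l := chartMetric γ.inner c) t hgd.hasFDerivAt hx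
  have hvt : v t = A y (ν t) := (chartGen_extChartAt hcs _).symm
  have had := ((hgx.clm_apply hV).congr_of_eventuallyEq (f₁ := a) (by
    filter_upwards [eventually_mem_source hg ht, self_mem_nhdsWithin] with s hs hsJ
    exact ha s hsJ hs) (ha t ht hcs)).derivWithin (hJ t ht)
  have hsymm : ∀ᶠ x in 𝓝 y, ∀ a b, chartMetric γ.inner c x a b = chartMetric γ.inner c x b a := by
    filter_upwards [extChartAt_target_mem_nhds c] with x hx
    exact (isNormalForm_chartMetric hγQ hx).symm
  have hn := isNormalForm_chartMetric hγQ hys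
  have hgi := isInvertible_of_pos (hn.pos (algMetric_symm γ) (algMetric_pos γ))
  have hw : chartDeriv c c w = w := congrArg (fun L : E →L[ℝ] E ↦ L w) (chartDeriv_self c)
  have hconn := fderiv_chartGen_add_christoffel hγQ (mem_horiz_group c (ξ t))
    (mem_horiz_group c (ν t))
  rw [← hy, ← hA] at hconn
  set ν' : E := (algMetric γ).inverse (derivWithin (F := E →L[ℝ] ℝ) μ J t) with hν'
  have hkν' : algMetric γ ν' = derivWithin (F := E →L[ℝ] ℝ) μ J t := hk.self_apply_inverse _
  set ζ : E := rightTransInv c w with hζ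
  have hwζ : (w : E) = A y ζ := by
    obtain ⟨η, hη⟩ := (infGen_bijective (E := E) c).2 w
    have h1 : ζ = η := by
      rw [hζ, ← hη]
      exact rightTransInv_infGen (E := E) c η
    rw [h1]
    exact hη.symm.trans (chartGen_self (E := E) (F := E) (G := G) c η).symm
  have hζh : IsHor (algMetric γ) (A y) ζ :=
    (isHor_chartGen_iff hcs ζ).2 (mem_horiz_group c ζ)
  have key : derivWithin a J t (A y ζ) - a t (christoffel γ.inner c y (A y (ξ t)) (A y ζ)) =
      derivWithin (F := E →L[ℝ] ℝ) μ J t ζ + algMetric γ (connTerm γ (ξ t) (ν t)) ζ := by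
    -- Compatibility trades the Christoffel term acting on the test vector for the one acting on V.
    have h1 := fderiv_sub_christoffelMap hgi hgd hsymm (A y (ξ t)) (A y (ν t)) (A y ζ)
    have hn' : IsNormalForm (algMetric γ) (A y) (chartMetric γ.inner c y) := hn
    have h2 := congrArg (fun u ↦ chartMetric γ.inner c y u (A y ζ)) hconn
    have h3 := hn'.apply_eq' (algMetric_symm γ) (algMetric_pos γ) hζh ν'
    have h5 := hn'.apply_eq' (algMetric_symm γ) (algMetric_pos γ) hζh (connTerm γ (ξ t) (ν t))
    rw [hkν'] at h3
    rw [← h3, ← h5, ← h2]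
    have h4 : a t = chartMetric γ.inner c y (A y (ν t)) := (ha t ht hcs).trans (by rw [hvt])
    have h6 : derivWithin a J t (A y ζ) =
        fderiv ℝ (chartMetric γ.inner c) y (A y (ξ t)) (A y (ν t)) (A y ζ) +
        (chartMetric γ.inner c y (A y ν') (A y ζ) +
          chartMetric γ.inner c y (fderiv ℝ A y (A y (ξ t)) (ν t)) (A y ζ)) := by
      rw [← add_apply, ← map_add, ← hvt]
      exact congrArg (fun L : E →L[ℝ] ℝ ↦ L (A y ζ)) had
    rw [h6, h4]
    refine Eq.trans ?_ (congrArg (_ + ·) (congrArg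
      (fun L : E →L[ℝ] ℝ ↦ L (A y ζ)) (map_add (chartMetric γ.inner c y) _ _)).symm)
    rw [add_apply]
    unfold christoffel at *
    linarith
  have hfin : ∀ (a b c d : E →L[ℝ] ℝ), (a - (1 / 2 : ℝ) • b + (1 / 2 : ℝ) • c +
      (1 / 2 : ℝ) • d) ζ = a ζ - 1 / 2 * b ζ + 1 / 2 * c ζ + 1 / 2 * d ζ := by
    intro a b c d; simp
  have hR : (derivWithin μ J t - (1 / 2 : ℝ) • flat γ ⁅ξ t, sharp γ (μ t)⁆
        + (1 / 2 : ℝ) • adStar (sharp γ (μ t)) (flat γ (ξ t))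
        + (1 / 2 : ℝ) • adStar (ξ t) (μ t)).comp (rightTransInv c) w =
      derivWithin (F := E →L[ℝ] ℝ) μ J t ζ - 1 / 2 * algMetric γ (algBracket G (ξ t) (ν t)) ζ +
        1 / 2 * algMetric γ (ξ t) (algBracket G (ν t) ζ) +
        1 / 2 * algMetric γ (ν t) (algBracket G (ξ t) ζ) := by
    rw [hkν]
    exact hfin _ _ _ _
  rw [hR]
  have hc := algMetric_connTerm γ (ξ t) (ν t) ζ
  have hL : covDerivAlongCovector γ.inner g α J t w =
      derivWithin a J t (A y ζ) - a t (christoffel γ.inner c y (A y (ξ t)) (A y ζ)) := by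
    rw [← hwζ, ← hx']
    exact congrArg (fun u : E ↦ derivWithin a J t u -
      a t (christoffel γ.inner c y (derivWithin x J t) u)) hw
  rw [hL, key]
  linarith

end Covector

end NormalMetrics

end

/-! ### Assembly of the four statements. -/

theorem proposition3p1
    {E : Type*} [NormedAddCommGroup E] [NormedSpace ℝ E] [FiniteDimensional ℝ E]
    {F : Type*} [NormedAddCommGroup F] [NormedSpace ℝ F] [FiniteDimensional ℝ F]
    {G : Type*} [TopologicalSpace G] [ChartedSpace E G] [Group G] [LieGroup 𝓘(ℝ, E) ∞ G]
    {Q : Type*} [TopologicalSpace Q] [ChartedSpace F Q] [IsManifold 𝓘(ℝ, F) ∞ Q]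
    [MulAction G Q] [ContMDiffSMul 𝓘(ℝ, E) 𝓘(ℝ, F) ∞ G Q] [MulAction.IsPretransitive G Q]
    (γ : Bundle.ContMDiffRiemannianMetric 𝓘(ℝ, E) ∞ E (TangentSpace 𝓘(ℝ, E) : G → Type _))
    (hγ : IsRightInvariant γ)
    (γQ : ∀ q : Q, TangentSpace 𝓘(ℝ, F) q →L[ℝ] TangentSpace 𝓘(ℝ, F) q →L[ℝ] ℝ)
    (hγQ : IsNormalMetric γ γQ)
    (J : Set ℝ) (hJ : J.OrdConnected) (hJ' : J.Nontrivial) :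
    -- the relation `v = ξ_G(g)` determines `ξ`
    (∀ (g : G) (v : TangentSpace 𝓘(ℝ, E) g),
      ∃! ξ : GroupLieAlgebra 𝓘(ℝ, E) G, v = infGen (F := E) g ξ) ∧
    -- (i)
    (∀ (g : ℝ → G) (ξ : ℝ → GroupLieAlgebra 𝓘(ℝ, E) G),
      ContMDiffOn 𝓘(ℝ, ℝ) 𝓘(ℝ, E) 2 g J →
      (∀ t ∈ J, velocity (E := E) g J t = infGen (F := E) (g t) (ξ t)) →
      ContDiffOn ℝ 1 (F := E) ξ J ∧
      ∀ t ∈ J, covDerivAlong γ.inner g (velocity (E := E) g J) J t =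
        infGen (F := E) (g t) (derivWithin ξ J t + adDagger γ (ξ t) (ξ t))) ∧
    -- (ii), vector fields along a curve
    (∀ (g : ℝ → G) (V : ∀ t, TangentSpace 𝓘(ℝ, E) (g t))
      (ξ ν : ℝ → GroupLieAlgebra 𝓘(ℝ, E) G),
      ContMDiffOn 𝓘(ℝ, ℝ) 𝓘(ℝ, E) 1 g J →
      ContMDiffOn 𝓘(ℝ, ℝ) 𝓘(ℝ, E).tangent 1 (fun t ↦ (⟨g t, V t⟩ : TangentBundle 𝓘(ℝ, E) G)) J →
      (∀ t ∈ J, velocity (E := E) g J t = infGen (F := E) (g t) (ξ t)) →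
      (∀ t ∈ J, V t = infGen (F := E) (g t) (ν t)) →
      ContDiffOn ℝ 1 (F := E) ν J ∧
      ∀ t ∈ J, covDerivAlong γ.inner g V J t =
        infGen (F := E) (g t) (derivWithin ν J t + (1 / 2 : ℝ) • adDagger γ (ξ t) (ν t)
          + (1 / 2 : ℝ) • adDagger γ (ν t) (ξ t) - (1 / 2 : ℝ) • ⁅ξ t, ν t⁆)) ∧
    -- (ii), covector fields along a curve
    (∀ (g : ℝ → G) (α : ∀ t, TangentSpace 𝓘(ℝ, E) (g t) →L[ℝ] ℝ)
      (ξ : ℝ → GroupLieAlgebra 𝓘(ℝ, E) G) (μ : ℝ → GroupLieAlgebra 𝓘(ℝ, E) G →L[ℝ] ℝ),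
      ContMDiffOn 𝓘(ℝ, ℝ) 𝓘(ℝ, E) 1 g J →
      ContMDiffOn 𝓘(ℝ, ℝ) (𝓘(ℝ, E).prod 𝓘(ℝ, E →L[ℝ] ℝ)) 1
        (fun t ↦ Bundle.TotalSpace.mk' (E →L[ℝ] ℝ)
          (E := fun x : G ↦ TangentSpace 𝓘(ℝ, E) x →L[ℝ] ℝ) (g t) (α t)) J →
      (∀ t ∈ J, velocity (E := E) g J t = infGen (F := E) (g t) (ξ t)) →
      (∀ t ∈ J, μ t = (α t).comp (rightTrans (g t))) →
      ContDiffOn ℝ 1 (F := E →L[ℝ] ℝ) μ J ∧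
      ∀ t ∈ J, ∀ w : TangentSpace 𝓘(ℝ, E) (g t), covDerivAlongCovector γ.inner g α J t w =
        (derivWithin μ J t - (1 / 2 : ℝ) • flat γ ⁅ξ t, sharp γ (μ t)⁆
          + (1 / 2 : ℝ) • adStar (sharp γ (μ t)) (flat γ (ξ t))
          + (1 / 2 : ℝ) • adStar (ξ t) (μ t)).comp (rightTransInv (g t)) w) ∧
    -- (iii), arbitrary generators
    (∀ (q : ℝ → Q) (ξ : ℝ → GroupLieAlgebra 𝓘(ℝ, E) G),
      ContMDiffOn 𝓘(ℝ, ℝ) 𝓘(ℝ, F) 2 q J → ContDiffOn ℝ 1 (F := E) ξ J →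
      (∀ t ∈ J, velocity (E := F) q J t = infGen (F := F) (q t) (ξ t)) →
      ∀ t ∈ J, covDerivAlong γQ q (velocity (E := F) q J) J t =
        infGen (F := F) (q t) (derivWithin ξ J t
          + adDagger γ (horProj F γ (q t) (ξ t)) (horProj F γ (q t) (ξ t)))
        + covDeriv γQ (fun x ↦ infGen (F := F) x (vertProj F γ (q t) (ξ t))) (q t) (velocity (E := F) q J t)) ∧
    -- (iii), the horizontal generator
    (∀ (q : ℝ → Q) (ξ : ℝ → GroupLieAlgebra 𝓘(ℝ, E) G),
      ContMDiffOn 𝓘(ℝ, ℝ) 𝓘(ℝ, F) 2 q J →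
      (∀ t ∈ J, ξ t ∈ horiz F γ (q t) ∧ velocity (E := F) q J t = infGen (F := F) (q t) (ξ t)) →
      ContDiffOn ℝ 1 (F := E) ξ J ∧
      ∀ t ∈ J, covDerivAlong γQ q (velocity (E := F) q J) J t =
        infGen (F := F) (q t) (derivWithin ξ J t + adDagger γ (ξ t) (ξ t))) ∧
    -- (iv), the horizontal generator in terms of the momentum map
    (∀ (q : Q) (v : TangentSpace 𝓘(ℝ, F) q) (ξ : GroupLieAlgebra 𝓘(ℝ, E) G),
      (ξ ∈ horiz F γ q ∧ v = infGen (F := F) q ξ) ↔ ξ = horGen γ γQ q v) ∧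
    -- (iv), the covariant derivative in terms of the momentum map
    (∀ q : ℝ → Q, ContMDiffOn 𝓘(ℝ, ℝ) 𝓘(ℝ, F) 2 q J →
      ContDiffOn ℝ 1 (F := E) (fun t ↦ horGen γ γQ (q t) (velocity (E := F) q J t)) J ∧
      ∀ t ∈ J, covDerivAlong γQ q (velocity (E := F) q J) J t =
        infGen (F := F) (q t) (derivWithin (fun s ↦ horGen γ γQ (q s) (velocity (E := F) q J s)) J t
          + adDagger γ (horGen γ γQ (q t) (velocity (E := F) q J t))
              (horGen γ γQ (q t) (velocity (E := F) q J t)))) := by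
  -- J is convex, and the midpoint of two distinct points of J is interior, so one-sided derivatives
  -- at endpoints are unique.
  have hJu : UniqueDiffOn ℝ J := by
    have hc : Convex ℝ J := hJ.convex
    refine uniqueDiffOn_convex hc ?_
    obtain ⟨a, ha, b, hb, hab⟩ := hJ'
    rcases lt_or_gt_of_ne hab with h | h
    · exact ⟨(a + b) / 2, interior_mono (hJ.out ha hb) (by
        rw [interior_Icc]; constructor <;> linarith)⟩
    · exact ⟨(a + b) / 2, interior_mono (hJ.out hb ha) (by
        rw [interior_Icc]; constructor <;> linarith)⟩
  have hγG := isNormalMetric_inner hγ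
  have h21 : (1 : ℕ∞ω) ≤ 2 := by norm_num
  -- Regularity of V is required only in charts, so that the velocity of a C² curve qualifies
  -- directly and (i) becomes the case V = ġ, ν = ξ.
  have hii : ∀ (g : ℝ → G) (V : ∀ t, TangentSpace 𝓘(ℝ, E) (g t))
      (ξ ν : ℝ → GroupLieAlgebra 𝓘(ℝ, E) G),
      ContMDiffOn 𝓘(ℝ, ℝ) 𝓘(ℝ, E) 1 g J → ContDiffAlongOn g V J →
      (∀ t ∈ J, velocity (E := E) g J t = infGen (F := E) (g t) (ξ t)) →
      (∀ t ∈ J, V t = infGen (F := E) (g t) (ν t)) →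
      ContDiffOn ℝ 1 (F := E) ν J ∧
      ∀ t ∈ J, covDerivAlong γ.inner g V J t =
        infGen (F := E) (g t) (derivWithin ν J t + connTerm γ (ξ t) (ν t)) := by
    intro g V ξ ν hg hV hξ hν
    have h1 := contDiffOn_horizontal hγG hg hV fun t ht ↦ ⟨mem_horiz_group (g t) (ν t), hν t ht⟩
    exact ⟨h1, fun t ht ↦ covDerivAlong_horizontal hγG hg hJu ht
      ((h1 t ht).differentiableWithinAt one_ne_zero) (hξ t ht) hν
      (mem_horiz_group (g t) (ξ t)) (mem_horiz_group (g t) (ν t))⟩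
  have hiii : ∀ (q : ℝ → Q) (ξ : ℝ → GroupLieAlgebra 𝓘(ℝ, E) G),
      ContMDiffOn 𝓘(ℝ, ℝ) 𝓘(ℝ, F) 2 q J →
      (∀ t ∈ J, ξ t ∈ horiz F γ (q t) ∧ velocity (E := F) q J t = infGen (F := F) (q t) (ξ t)) →
      ContDiffOn ℝ 1 (F := E) ξ J ∧
      ∀ t ∈ J, covDerivAlong γQ q (velocity (E := F) q J) J t =
        infGen (F := F) (q t) (derivWithin ξ J t + adDagger γ (ξ t) (ξ t)) := by
    intro q ξ hq hξ
    have h1 := contDiffOn_horizontal hγQ (hq.of_le h21) (contDiffAlongOn_velocity hq hJu) hξ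
    refine ⟨h1, fun t ht ↦ ?_⟩
    rw [← connTerm_self]
    exact covDerivAlong_horizontal hγQ (hq.of_le h21) hJu ht
      ((h1 t ht).differentiableWithinAt one_ne_zero) (hξ t ht).2 (fun t ht ↦ (hξ t ht).2)
      (hξ t ht).1 (hξ t ht).1
  refine ⟨fun g v ↦ ?_, fun g ξ hg hξ ↦ ?_, fun g V ξ ν hg hV hξ hν ↦ ?_,
    fun g α ξ μ hg hα hξ hμ ↦ ?_, fun q ξ hq hξ hv t ht ↦ ?_, hiii,
    horizontal_iff_horGen hγQ, fun q hq ↦ ?_⟩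
  · obtain ⟨ξ, hξ⟩ := (infGen_bijective g).2 v
    exact ⟨ξ, hξ.symm, fun ζ hζ ↦ infGen_injective g (hζ.symm.trans hξ.symm)⟩
  · have h := hii g (velocity (E := E) g J) ξ ξ (hg.of_le h21) (contDiffAlongOn_velocity hg hJu)
      hξ hξ
    refine ⟨h.1, fun t ht ↦ ?_⟩
    rw [← connTerm_self]
    exact h.2 t ht
  · have h := hii g V ξ ν hg (contDiffAlongOn_of_contMDiffOn hV) hξ hν
    refine ⟨h.1, fun t ht ↦ ?_⟩
    rw [h.2 t ht, connTerm, add_sub_assoc, add_sub_assoc, add_assoc]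
  · have h := contDiffOn_pullback_covector hg hα hμ
    exact ⟨h, fun t ht w ↦ covDerivAlongCovector_eq hγ hg hJu ht (hξ t ht) hμ
      ((h t ht).differentiableWithinAt one_ne_zero) w⟩
  · exact covDerivAlong_velocity hγQ (hq.of_le h21) hJu ht
      ((hξ t ht).differentiableWithinAt one_ne_zero) hv
  · exact hiii q _ hq fun t ht ↦ (horizontal_iff_horGen hγQ (q t) _ _).2 rfl
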